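/- Write $\hat\psi(k)=\int_{\mathbb R^d}e^{-ik\cdot x}\psi(x)\,dx$ for the Fourier transform, extended to $L^2(\mathbb R^d)$, and let $\sigma>0$ and $V:\mathbb R^d\to\mathbb R$ be measurable. Assume that one of the following holds. (a) $d\ge 1$ and $H=A-\sigma V(x)$ in $L^2(\mathbb R^d)$, where $A$ is the Fourier multiplier $\widehat{A\psi}(k)=a(k)\hat\psi(k)$ with its maximal domain $\{\psi\in L^2: a\hat\psi\in L^2\}$. Here $a:\mathbb R^d\to\mathbb R$ is continuous, $a(k)>0$ for $k\ne 0$, there is a constant $C$ with $a(k)\le C|k|^d$ for all $k$ in a neighbourhood of $0$, and $a(k)\to\infty$ as $|k|\to\infty$. The potential $V$ is bounded and $V(x)\to 0$ as $|x|\to\infty$. (b) $d=2$ and $H=-\Delta-\sigma V(x)$ in $L^2(\mathbb R^2)$, where, with $V_+=\max(V,0)$, $$\int_{\mathbb R^2}V_+(x)\ln(2+|x|)\,dx+\int_{\{V>1\}}V(x)\ln V(x)\,dx<\infty .$$ Here $H$ is the operator associated with the quadratic form $q(u,v)=\int\nabla u\cdot\overline{\nabla v}\,dx-\sigma\int V u\overline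 v\,dx$ on $Q=\{u\in H^1(\mathbb R^2):\int|V||u|^2dx<\infty\}$; that is, $u\in D(H)$ and $Hu=f$ if and only if $u\in Q$ and $q(u,v)=\langle f,v\rangle$ for all $v\in Q$. (If $Q$ is not dense in $L^2$, which cannot occur when $V$ is locally integrable, $H$ is understood as the operator so defined in the closure of $Q$.) Then the negative spectrum of $H$ is discrete: every $\lambda<0$ in the spectrum of $H$ is an isolated point of the spectrum and an eigenvalue of $H$ of finite multiplicity. -/

import Mathlib

open MeasureTheory Filter Topology

noncomputable section

namespace NegSpec

/-- The Euclidean space `ℝ^d`. -/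
abbrev Space (d : ℕ) := EuclideanSpace ℝ (Fin d)

/-- The complex Hilbert space `L²(X)`. -/
abbrev L2 (X : Type*) [MeasureSpace X] := Lp ℂ 2 (volume : Measure X)

section Spectrum

/-! An unbounded operator `T` is studied through its graph `G = {(u, T u) : u ∈ D(T)}`. -/

variable {E : Type*} [NormedAddCommGroup E] [NormedSpace ℂ E]

/-- `z` is in the resolvent set of the operator `T` with graph `G`: there is a bounded, everywhere
defined `R` such that `u = R g` if and only if `u ∈ D(T)` and `(T - z) u = g`. -/
def IsResolventPoint (G : Submodule ℂ (E × E)) (z : ℂ) : Prop :=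
  ∃ R : E →L[ℂ] E, ∀ u g : E, (u, g + z • u) ∈ G ↔ u = R g

/-- The spectrum of the operator with graph `G`. -/
def spec (G : Submodule ℂ (E × E)) : Set ℂ := {z | ¬ IsResolventPoint G z}

/-- The eigenspace `{u ∈ D(T) : T u = z u}` of the operator `T` with graph `G`. -/
def eigenspaceOf (G : Submodule ℂ (E × E)) (z : ℂ) : Submodule ℂ E :=
  G.comap (LinearMap.id.prod (z • LinearMap.id))

/-- The negative spectrum is discrete: every `μ < 0` in the spectrum is an isolated point of
the spectrum and an eigenvalue of finite multiplicity. -/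
def HasDiscreteNegativeSpectrum (G : Submodule ℂ (E × E)) : Prop :=
  ∀ μ : ℝ, μ < 0 → (μ : ℂ) ∈ spec G →
    (∀ᶠ z in 𝓝[≠] (μ : ℂ), z ∉ spec G) ∧
    eigenspaceOf G μ ≠ ⊥ ∧ FiniteDimensional ℂ (eigenspaceOf G μ)

end Spectrum

section Operators

/-- The maximal operator of multiplication by the real function `m` in `L²(X)`, with domain
`{u ∈ L² : m u ∈ L²}`. -/
def mulOp {X : Type*} [MeasureSpace X] (m : X → ℝ) : L2 X →ₗ.[ℂ] L2 X where
  domain :=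
    { carrier := {u | MemLp (fun x => (m x : ℂ) * u x) 2 volume}
      zero_mem' := by
        refine (MemLp.zero (ε := ℂ) (p := 2) (μ := (volume : Measure X))).ae_eq ?_
        filter_upwards [Lp.coeFn_zero ℂ 2 (volume : Measure X)] with x hx
        simp only [hx, Pi.zero_apply, mul_zero]
      add_mem' := by
        intro u v hu hv
        refine (MemLp.add hu hv).ae_eq ?_
        filter_upwards [Lp.coeFn_add u v] with x hx
        simp only [hx, Pi.add_apply, mul_add]
      smul_mem' := by
        intro c u hu
        refine (MemLp.const_smul hu c).ae_eq ?_
        filter_upwards [Lp.coeFn_smul c u] with x hx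
        simp [hx, mul_left_comm] }
  toFun :=
    { toFun := fun u => MemLp.toLp (fun x => (m x : ℂ) * (u : L2 X) x) u.2
      map_add' := by
        intro u v
        rw [← MemLp.toLp_add]
        refine MemLp.toLp_congr _ _ ?_
        filter_upwards [Lp.coeFn_add (u : L2 X) (v : L2 X)] with x hx
        simp only [Submodule.coe_add, hx, Pi.add_apply, mul_add]
      map_smul' := by
        intro c u
        rw [RingHom.id_apply, ← MemLp.toLp_const_smul]
        refine MemLp.toLp_congr _ _ ?_
        filter_upwards [Lp.coeFn_smul c (u : L2 X)] with x hx
        simp [hx, mul_left_comm] }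

/-- Mathlib's unitary Fourier transform on `L²(ℝ^d)`, with kernel `exp (-2πi ⟨x, ξ⟩)`. -/
abbrev fourierL2 (d : ℕ) : L2 (Space d) ≃ₗᵢ[ℂ] L2 (Space d) :=
  Lp.fourierTransformₗᵢ (Space d) ℂ

/-- The Fourier multiplier `A = a(-i∇)` with its maximal domain: in the frequency variable
`k = 2πξ`, `(A ψ)^(k) = a(k) ψ^(k)`. Thus `a(k) = |k|²` gives `-Δ`. -/
def fourierOp {d : ℕ} (a : Space d → ℝ) : L2 (Space d) →ₗ.[ℂ] L2 (Space d) where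
  domain := (mulOp fun ξ => a ((2 * Real.pi) • ξ)).domain.comap
    (fourierL2 d).toLinearEquiv.toLinearMap
  toFun := (fourierL2 d).symm.toLinearEquiv.toLinearMap ∘ₗ
    (mulOp fun ξ => a ((2 * Real.pi) • ξ)).toFun ∘ₗ
      ((fourierL2 d).toLinearEquiv.toLinearMap.restrict fun _ h => h)

end Operators

section Form

variable {d : ℕ}

/-- The operator `|∇| = (-Δ)^{1/2}`; its domain is the Sobolev space `H¹(ℝ^d)`. -/
def absGrad (d : ℕ) : L2 (Space d) →ₗ.[ℂ] L2 (Space d) := fourierOp fun k => ‖k‖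

/-- The form domain of `-Δ - W`: all `u ∈ H¹(ℝ^d)` with `∫ |W| |u|² < ∞`. -/
def formDomain (W : Space d → ℝ) : Submodule ℂ (L2 (Space d)) :=
  (absGrad d).domain ⊓ (mulOp fun x => Real.sqrt |W x|).domain

/-- The quadratic form of `-Δ - W`, polarized: `∫ ∇u · conj ∇v - ∫ W u conj v`. The first
integral is written as the `L²` inner product of `|∇| u` and `|∇| v`. -/
def schrodingerForm (W : Space d → ℝ) (u v : formDomain W) : ℂ :=
  inner ℂ (absGrad d ⟨v, v.2.1⟩) (absGrad d ⟨u, u.2.1⟩)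
    - ∫ x, (W x : ℂ) * (u : L2 (Space d)) x * starRingEnd ℂ ((v : L2 (Space d)) x)

lemma integrable_potential {W : Space d → ℝ} (hW : AEMeasurable W volume) (u v : formDomain W) :
    Integrable (fun x => (W x : ℂ) * (u : L2 (Space d)) x *
      starRingEnd ℂ ((v : L2 (Space d)) x)) volume := by
  have hu : MemLp (fun x => ((Real.sqrt |W x| : ℝ) : ℂ) * (u : L2 (Space d)) x) 2 volume := u.2.2
  have hv : MemLp (fun x => ((Real.sqrt |W x| : ℝ) : ℂ) * (v : L2 (Space d)) x) 2 volume := v.2.2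
  refine (hu.norm.integrable_mul hv.norm).mono' ?_ (ae_of_all _ fun x => ?_)
  · exact ((Complex.measurable_ofReal.comp_aemeasurable hW).aestronglyMeasurable.mul
      (Lp.aestronglyMeasurable _)).mul
        (Complex.continuous_conj.comp_aestronglyMeasurable (Lp.aestronglyMeasurable _))
  · have h : Real.sqrt |W x| * Real.sqrt |W x| = |W x| := Real.mul_self_sqrt (abs_nonneg _)
    simp only [norm_mul, RCLike.norm_conj, Complex.norm_real, Real.norm_eq_abs, Pi.mul_apply,
      abs_of_nonneg (Real.sqrt_nonneg _)]
    calc |W x| * ‖(u : L2 (Space d)) x‖ * ‖(v : L2 (Space d)) x‖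
        = (Real.sqrt |W x| * Real.sqrt |W x|) * ‖(u : L2 (Space d)) x‖ *
            ‖(v : L2 (Space d)) x‖ := by rw [h]
      _ ≤ _ := le_of_eq (by ring)

lemma schrodingerForm_add {W : Space d → ℝ} (hW : AEMeasurable W volume)
    (u u' v : formDomain W) :
    schrodingerForm W (u + u') v = schrodingerForm W u v + schrodingerForm W u' v := by
  have h1 : absGrad d ⟨_, (u + u').2.1⟩ =
      absGrad d ⟨_, u.2.1⟩ + absGrad d ⟨_, u'.2.1⟩ :=
    (absGrad d).toFun.map_add ⟨_, u.2.1⟩ ⟨_, u'.2.1⟩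
  have h2 : (∫ x, (W x : ℂ) * ((u + u' : formDomain W) : L2 (Space d)) x *
        starRingEnd ℂ ((v : L2 (Space d)) x)) =
      (∫ x, (W x : ℂ) * (u : L2 (Space d)) x * starRingEnd ℂ ((v : L2 (Space d)) x)) +
      ∫ x, (W x : ℂ) * (u' : L2 (Space d)) x * starRingEnd ℂ ((v : L2 (Space d)) x) := by
    rw [← integral_add (integrable_potential hW u v) (integrable_potential hW u' v)]
    refine integral_congr_ae ?_
    filter_upwards [Lp.coeFn_add (u : L2 (Space d)) (u' : L2 (Space d))] with x hx
    simp only [Submodule.coe_add, hx, Pi.add_apply]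
    ring
  unfold schrodingerForm
  rw [h1, h2, inner_add_right]
  ring

lemma schrodingerForm_smul (W : Space d → ℝ) (c : ℂ) (u v : formDomain W) :
    schrodingerForm W (c • u) v = c * schrodingerForm W u v := by
  have h1 : absGrad d ⟨_, (c • u).2.1⟩ = c • absGrad d ⟨_, u.2.1⟩ :=
    (absGrad d).toFun.map_smul c ⟨_, u.2.1⟩
  have h2 : (∫ x, (W x : ℂ) * ((c • u : formDomain W) : L2 (Space d)) x *
        starRingEnd ℂ ((v : L2 (Space d)) x)) =
      c * ∫ x, (W x : ℂ) * (u : L2 (Space d)) x * starRingEnd ℂ ((v : L2 (Space d)) x) := by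
    rw [← integral_const_mul]
    refine integral_congr_ae ?_
    filter_upwards [Lp.coeFn_smul c (u : L2 (Space d))] with x hx
    simp only [Submodule.coe_smul, hx, Pi.smul_apply, smul_eq_mul]
    ring
  unfold schrodingerForm
  rw [h1, h2, inner_smul_right]
  ring

/-- The graph of the Schrödinger operator `H = -Δ - W` associated with its quadratic form `q`:
`u ∈ D(H)` and `H u = f` if and only if `u` is in the form domain `Q` and `q(u, v) = ⟨f, v⟩` for
all `v ∈ Q`. If `Q` is dense in `L²` (in particular if `W` is locally integrable) then `f` is
determined by `u`. In general `f` is determined up to the orthogonal complement of `Q`, and the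
resolvent set, the spectrum and the eigenspaces defined above are those of the operator associated
with `q` in the closure of `Q`. -/
def schrodingerGraph (W : Space d → ℝ) (hW : AEMeasurable W volume) :
    Submodule ℂ (L2 (Space d) × L2 (Space d)) where
  carrier := {p | ∃ hu : p.1 ∈ formDomain W, ∀ v : formDomain W,
    schrodingerForm W ⟨p.1, hu⟩ v = inner ℂ (v : L2 (Space d)) p.2}
  zero_mem' := by
    refine ⟨(formDomain W).zero_mem, fun v => ?_⟩
    have := schrodingerForm_smul W 0 0 v
    rw [zero_smul, zero_mul] at this
    exact this.trans (inner_zero_right _).symm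
  add_mem' := by
    rintro ⟨u, f⟩ ⟨u', f'⟩ ⟨hu, h⟩ ⟨hu', h'⟩
    refine ⟨(formDomain W).add_mem hu hu', fun v => ?_⟩
    have := schrodingerForm_add hW ⟨u, hu⟩ ⟨u', hu'⟩ v
    rw [h v, h' v, ← inner_add_right] at this
    exact this
  smul_mem' := by
    rintro c ⟨u, f⟩ ⟨hu, h⟩
    refine ⟨(formDomain W).smul_mem c hu, fun v => ?_⟩
    have := schrodingerForm_smul W c ⟨u, hu⟩ v
    rw [h v, ← inner_smul_right] at this
    exact this

end Form

end NegSpec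

end

/-!
Both operators are treated through one bounded operator. If `R` is the resolvent at some `-c < μ`,
then `z` near `μ` is in the resolvent set as soon as `1 - (z + c) R` is invertible, and the
eigenspace at `μ` is the kernel of `1 - (μ + c) R`. When `R = S + K` with `‖S‖ ≤ 1 / c` and `K`
compact, `1 - (z + c) R` is a compact perturbation of the invertible operator `1 - (z + c) S`, and
the Fredholm alternative together with the symmetry of `R` gives the three assertions
(`discrete_spec_of_resolvent`).

For a multiplier `A` and a bounded potential, `S = (A + c)⁻¹` and the Neumann series gives `R`;
`K` is compact because `σ V (A + c)⁻¹` is (`discrete_spec_of_bounded_perturbation`). The latter is a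
norm limit of operators `w(x) m(-i∇)` with `w`, `m` bounded and of bounded support, which are
Carleman operators of square-integrable families of functionals
(`isCompactOperator_potMul_of_tendsto`).

For the form of `-Δ - W` in the plane, put `u = (-Δ + c)^{-1/2} g` and `h = √W₋ u`. The form shifted
by `c` becomes `‖g‖² + ‖h‖² - ‖M g‖²` on a closed space of pairs `(g, h)`, where
`M = √W₊ (-Δ + c)^{-1/2}`, so that it suffices that `M` is compact with norm less than `1` for large
`c` (`discrete_schrodinger_of_compact`); no regularity of `W₋` is needed. The truncations of `W₊` at
finite levels give compact operators, of small norm if `c` is large, and `M` is their norm limit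
because the contribution of high values is small (`norm_potMul_sqrt_le`). The last point is where
the entropy integral enters. With the heat kernel `p_t` and
`(-Δ + 1)⁻¹ = ∫₀^∞ e^{-t} e^{tΔ} dt`, Schur's test reduces it to a uniform bound for
`∫₀^∞ e^{-t} (p_t * w)(x) dt` with `w = W₊ 1_{W₊ > N}`. At time `t` the values of `w` below
`t^{-1/2}` occur only for `t < N⁻²` and contribute at most `2 / N` in total, by `∫ p_t = 1`, while
those above contribute at most `∫ w (2 log w + 1)`, by `p_t ≤ (4πt)⁻¹`
(`lintegral_heatKernel_potential_le`).
-/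

noncomputable section

namespace NegSpec

/-! ### Discrete spectrum from a compact perturbation of the resolvent -/

section Abstract

variable {E : Type*} [NormedAddCommGroup E] [InnerProductSpace ℂ E]

/-- Fredholm alternative for compact perturbations of an invertible operator. -/
lemma isUnit_add_of_isCompactOperator [CompleteSpace E] {B K : E →L[ℂ] E} (hB : IsUnit B)
    (hK : IsCompactOperator K) (hinj : ∀ u, (B + K) u = 0 → u = 0) : IsUnit (B + K) := by
  obtain ⟨B, rfl⟩ := hB
  have hK' : IsCompactOperator (-((↑B⁻¹ : E →L[ℂ] E) * K) : E →L[ℂ] E) :=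
    (hK.clm_comp (↑B⁻¹ : E →L[ℂ] E)).neg
  have hfac : (B : E →L[ℂ] E) + K = B * (1 - (-((↑B⁻¹ : E →L[ℂ] E) * K))) := by
    rw [sub_neg_eq_add, mul_add, mul_one, ← mul_assoc, Units.mul_inv, one_mul]
  rw [hfac]
  refine B.isUnit.mul ?_
  rcases hK'.hasEigenvalue_or_mem_resolventSet (one_ne_zero (α := ℂ)) with h | h
  · obtain ⟨u, hu⟩ := h.exists_hasEigenvector
    refine (hu.2 (hinj u ?_)).elim
    have h1 : (-((↑B⁻¹ : E →L[ℂ] E) * K)) u = u := by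
      simpa using hu.apply_eq_smul
    rw [hfac, mul_apply_eq_comp, sub_apply, h1]
    simp
  · simpa [spectrum.mem_resolventSet_iff] using h

/-- The kernel of a compact perturbation of an invertible operator is finite-dimensional. -/
lemma finiteDimensional_ker_add {B K : E →L[ℂ] E} (hB : IsUnit B)
    (hK : IsCompactOperator K) : FiniteDimensional ℂ (B + K).ker := by
  obtain ⟨B, rfl⟩ := hB
  have hcl : IsClosed ((B + K : E →L[ℂ] E).ker : Set E) := (B + K : E →L[ℂ] E).isClosed_ker
  have hK' : IsCompactOperator ((-((↑B⁻¹ : E →L[ℂ] E) * K) : E →L[ℂ] E) ∘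
      ((B + K : E →L[ℂ] E).ker).subtypeL) :=
    ((hK.clm_comp (↑B⁻¹ : E →L[ℂ] E)).neg).comp_clm _
  have hid : ∀ u : (B + K : E →L[ℂ] E).ker,
      ((-((↑B⁻¹ : E →L[ℂ] E) * K) : E →L[ℂ] E) ∘ ((B + K : E →L[ℂ] E).ker).subtypeL) u = u := by
    intro u
    have hu : (B : E →L[ℂ] E) u + K u = 0 := u.2
    have h2 : (↑B⁻¹ : E →L[ℂ] E) ((B : E →L[ℂ] E) u + K u) = 0 := by rw [hu, map_zero]
    rw [map_add, ← mul_apply_eq_comp, Units.inv_mul] at h2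
    simp only [Function.comp_apply, Submodule.subtypeL_apply, neg_apply,
      mul_apply_eq_comp]
    exact (eq_neg_of_add_eq_zero_left h2).symm
  have hmem : ∀ u : (B + K : E →L[ℂ] E).ker,
      ((-((↑B⁻¹ : E →L[ℂ] E) * K) : E →L[ℂ] E) ∘ ((B + K : E →L[ℂ] E).ker).subtypeL) u ∈
        (B + K : E →L[ℂ] E).ker := fun u => (hid u).symm ▸ u.2
  have := hK'.codRestrict hmem hcl
  refine FiniteDimensional.of_isCompactOperator_id (𝕜 := ℂ) ?_
  rwa [show Set.codRestrict _ _ hmem = id from funext fun u => Subtype.ext (hid u)] at this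

/-- Let `R` be the resolvent at `-c` of the operator with graph `G`. If `R` is symmetric and a
compact perturbation of an operator of norm at most `1 / c`, then the spectrum is discrete in
`(-c, 0)`: for `z` near such a point, `z` is in the resolvent set as soon as `1 - (z + c) R` is
invertible, and this operator is a compact perturbation of an invertible one. -/
theorem discrete_spec_of_resolvent [CompleteSpace E] {G : Submodule ℂ (E × E)} {c μ : ℝ} (hμ : μ < 0)
    (hc : -μ < c) {R S K : E →L[ℂ] E}
    (hG : ∀ u g : E, (u, g + (-c : ℂ) • u) ∈ G ↔ u = R g) (hRS : R = S + K)
    (hR : ∀ u v : E, inner ℂ (R u) v = inner ℂ u (R v)) (hS : ‖S‖ ≤ 1 / c)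
    (hK : IsCompactOperator K) (hspec : (μ : ℂ) ∈ spec G) :
    (∀ᶠ z in 𝓝[≠] (μ : ℂ), z ∉ spec G) ∧
      eigenspaceOf G μ ≠ ⊥ ∧ FiniteDimensional ℂ (eigenspaceOf G μ) := by
  have hc0 : 0 < c := by linarith
  have ht : ((μ : ℂ) + c) ≠ 0 := by
    norm_cast
    linarith
  let A : ℂ → E →L[ℂ] E := fun z => 1 - (z + c) • R
  have hAB : ∀ z, A z = (1 - (z + c) • S) + (-(z + c)) • K := by
    intro z
    simp only [A, hRS, smul_add, neg_smul]
    abel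
  have hres : ∀ z, IsUnit (A z) → z ∉ spec G := by
    intro z hz
    obtain ⟨U, hU⟩ := hz
    refine fun h => h ⟨(↑U⁻¹ : E →L[ℂ] E) * R, fun u g => ?_⟩
    have h1 : g + z • u = (g + (z + c) • u) + (-c : ℂ) • u := by module
    rw [h1, hG, map_add, map_smul]
    have h2 : u = R g + (z + c) • R u ↔ A z u = R g := by
      simp only [A, sub_apply, one_apply_eq_self, smul_apply]
      rw [sub_eq_iff_eq_add]
    rw [h2, ← hU, mul_apply_eq_comp]
    constructor
    · intro h
      rw [← h, ← mul_apply_eq_comp, Units.inv_mul, one_apply_eq_self]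
    · intro h
      rw [h, ← mul_apply_eq_comp, Units.mul_inv, one_apply_eq_self]
  have heig : eigenspaceOf G μ = (A μ).ker := by
    ext u
    have h1 : ((μ : ℂ) • u) = ((μ + c : ℂ) • u) + (-c : ℂ) • u := by module
    change (u, (μ : ℂ) • u) ∈ G ↔ A μ u = 0
    rw [h1, hG, map_smul]
    simp only [A, sub_apply, one_apply_eq_self, smul_apply]
    rw [sub_eq_zero]
  have hcontA : Continuous A := by fun_prop
  have hBunit : IsUnit (1 - ((μ : ℂ) + c) • S) := by
    refine isUnit_one_sub_of_norm_lt_one ?_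
    have h1 : ‖((μ : ℂ) + c)‖ = μ + c := by
      rw [← Complex.ofReal_add, Complex.norm_real, Real.norm_of_nonneg (by linarith)]
    rw [norm_smul, h1]
    calc (μ + c) * ‖S‖ ≤ (μ + c) * (1 / c) := by gcongr; linarith
      _ < 1 := by rw [mul_one_div, div_lt_one hc0]; linarith
  have hBev : ∀ᶠ z : ℂ in 𝓝 (μ : ℂ), IsUnit (1 - (z + c) • S) :=
    (show Continuous fun z : ℂ => 1 - (z + (c : ℂ)) • S by fun_prop).continuousAt.eventually
      (Units.isOpen.mem_nhds hBunit)
  have hfd : FiniteDimensional ℂ (A μ).ker := by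
    rw [hAB]
    exact finiteDimensional_ker_add hBunit (hK.smul _)
  have hne : (A μ).ker ≠ ⊥ := by
    intro hbot
    refine hres μ ?_ hspec
    have hinj : ∀ u, A μ u = 0 → u = 0 := fun u hu =>
      (Submodule.mem_bot ℂ).1 (hbot ▸ (show u ∈ (A μ).ker from hu))
    rw [hAB] at hinj ⊢
    exact isUnit_add_of_isCompactOperator hBunit (hK.smul _) hinj
  refine ⟨?_, heig ▸ hne, heig ▸ hfd⟩
  -- the orthogonal projection onto the eigenspace commutes with `R`
  set N := (A μ).ker with hN
  let P : E →L[ℂ] E := N.starProjection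
  have hPR : ∀ u, P (R u) = ((μ : ℂ) + c)⁻¹ • P u := by
    intro u
    refine ext_inner_left ℂ fun v => ?_
    have h1 : R (P v) = ((μ : ℂ) + c)⁻¹ • P v := by
      have h : A μ (P v) = 0 := N.starProjection_apply_mem v
      simp only [A, sub_apply, one_apply_eq_self, smul_apply] at h
      rw [eq_inv_smul_iff₀ ht]
      exact (sub_eq_zero.1 h).symm
    have hconj : starRingEnd ℂ ((μ : ℂ) + c)⁻¹ = ((μ : ℂ) + c)⁻¹ := by
      rw [← Complex.ofReal_add, ← Complex.ofReal_inv, Complex.conj_ofReal]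
    rw [← N.inner_starProjection_left_eq_right, ← hR, h1, inner_smul_left, hconj,
      inner_smul_right, ← N.inner_starProjection_left_eq_right]
  have hPP : ∀ u, P (P u) = P u := fun u =>
    N.starProjection_eq_self_iff.2 (N.starProjection_apply_mem u)
  have hPA : ∀ z u, P (A z u) = (1 - (z + c) * ((μ : ℂ) + c)⁻¹) • P u := by
    intro z u
    simp only [A, sub_apply, one_apply_eq_self, smul_apply, map_sub, map_smul, hPR]
    module
  have hPcompact : IsCompactOperator P :=
    by
    have := FiniteDimensional.proper ℂ N
    exact (isCompactOperator_of_locallyCompactSpace_dom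
      N.orthogonalProjectionOnto).clm_comp N.subtypeL
  have hAP : IsUnit (A μ + P) := by
    have h : A μ + P = (1 - ((μ : ℂ) + c) • S) + ((-((μ : ℂ) + c)) • K + P) := by
      rw [hAB, add_assoc]
    have hinj : ∀ u, (A μ + P) u = 0 → u = 0 := by
      intro u hu
      have h1 : P ((A μ + P) u) = 0 := by rw [hu, map_zero]
      rw [add_apply, map_add, hPA, hPP, mul_inv_cancel₀ ht, sub_self, zero_smul, zero_add] at h1
      rw [add_apply, h1, add_zero] at hu
      rw [← h1]
      exact (N.starProjection_eq_self_iff.2 (show u ∈ N from hu)).symm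
    rw [h] at hinj ⊢
    exact isUnit_add_of_isCompactOperator hBunit ((hK.smul _).add hPcompact) hinj
  have hAPev : ∀ᶠ z in 𝓝 (μ : ℂ), IsUnit (A z + P) :=
    (hcontA.add continuous_const).continuousAt.eventually (Units.isOpen.mem_nhds hAP)
  filter_upwards [hBev.filter_mono nhdsWithin_le_nhds, hAPev.filter_mono nhdsWithin_le_nhds,
    self_mem_nhdsWithin] with z hz1 hz2 hz3
  have hinj : ∀ u, A z u = 0 → u = 0 := by
    intro u hu
    have h1 : P (A z u) = 0 := by rw [hu, map_zero]
    have h2 : P u = 0 := by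
      rw [hPA] at h1
      refine (smul_eq_zero.1 h1).resolve_left fun h => hz3 ?_
      rw [sub_eq_zero, eq_comm, mul_inv_eq_one₀ ht] at h
      exact add_right_cancel h
    obtain ⟨U, hU⟩ := hz2
    have h3 : (U : E →L[ℂ] E) u = 0 := by rw [hU, add_apply, hu, h2, add_zero]
    rw [← one_apply_eq_self (F := E →L[ℂ] E) u, ← Units.inv_mul U, mul_apply_eq_comp, h3, map_zero]
  refine hres z ?_
  rw [hAB] at hinj ⊢
  exact isUnit_add_of_isCompactOperator hz1 (hK.smul _) hinj

end Abstract

/-! ### Multiplication by bounded functions -/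

section Multiplication

variable {X : Type*} [MeasureSpace X]

/-- An almost everywhere measurable function that is bounded everywhere. -/
structure IsBddMul (m : X → ℝ) : Prop where
  aemeasurable : AEMeasurable m volume
  bdd : ∃ C : ℝ, ∀ x, |m x| ≤ C

lemma IsBddMul.memLp {m : X → ℝ} (hm : IsBddMul m) {f : X → ℂ} (hf : MemLp f 2 volume) :
    MemLp (fun x => (m x : ℂ) * f x) 2 volume := by
  obtain ⟨C, hC⟩ := hm.bdd
  refine hf.of_le_mul (c := C) ((Complex.measurable_ofReal.comp_aemeasurable
    hm.aemeasurable).aestronglyMeasurable.mul hf.1) (ae_of_all _ fun x => ?_)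
  rw [norm_mul, Complex.norm_real, Real.norm_eq_abs]
  exact mul_le_mul_of_nonneg_right (hC x) (norm_nonneg _)

/-- Multiplication by `m` as a linear map, for bounded `m`. -/
def mulLin (m : X → ℝ) (hm : IsBddMul m) : L2 X →ₗ[ℂ] L2 X where
  toFun u := (hm.memLp (Lp.memLp u)).toLp
  map_add' u v := by
    rw [← MemLp.toLp_add]
    refine MemLp.toLp_congr _ _ ?_
    filter_upwards [Lp.coeFn_add u v] with x hx
    simp only [hx, Pi.add_apply, mul_add]
  map_smul' c u := by
    rw [RingHom.id_apply, ← MemLp.toLp_const_smul]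
    refine MemLp.toLp_congr _ _ ?_
    filter_upwards [Lp.coeFn_smul c u] with x hx
    simp [hx, mul_left_comm]

lemma norm_mulLin_le (m : X → ℝ) (hm : IsBddMul m) {C : ℝ} (hC : ∀ x, |m x| ≤ C) (u : L2 X) :
    ‖mulLin m hm u‖ ≤ C * ‖u‖ := by
  refine Lp.norm_le_mul_norm_of_ae_le_mul ?_
  filter_upwards [(hm.memLp (Lp.memLp u)).coeFn_toLp] with x hx
  change ‖(hm.memLp (Lp.memLp u)).toLp _ x‖ ≤ _
  rw [hx, norm_mul, Complex.norm_real, Real.norm_eq_abs]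
  exact mul_le_mul_of_nonneg_right (hC x) (norm_nonneg _)

open Classical in
/-- Multiplication by `m` as a bounded operator on `L²`; it is `0` unless `m` is bounded and
measurable. -/
def mulCLM (m : X → ℝ) : L2 X →L[ℂ] L2 X :=
  if hm : IsBddMul m then
    (mulLin m hm).mkContinuous hm.bdd.choose (norm_mulLin_le m hm hm.bdd.choose_spec)
  else 0

lemma coeFn_mulCLM {m : X → ℝ} (hm : IsBddMul m) (u : L2 X) :
    mulCLM m u =ᵐ[volume] fun x => (m x : ℂ) * u x := by
  rw [mulCLM, dif_pos hm]
  exact (hm.memLp (Lp.memLp u)).coeFn_toLp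

lemma norm_mulCLM_le {m : X → ℝ} (hm : AEMeasurable m volume) {C : ℝ} (h0 : 0 ≤ C)
    (hC : ∀ x, |m x| ≤ C) : ‖mulCLM m‖ ≤ C := by
  have hm' : IsBddMul m := ⟨hm, C, hC⟩
  rw [mulCLM, dif_pos hm']
  exact ContinuousLinearMap.opNorm_le_bound _ h0 fun u => norm_mulLin_le m hm' hC u

lemma IsBddMul.sub {m n : X → ℝ} (hm : IsBddMul m) (hn : IsBddMul n) :
    IsBddMul fun x => m x - n x := by
  obtain ⟨C, hC⟩ := hm.bdd
  obtain ⟨D, hD⟩ := hn.bdd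
  exact ⟨hm.aemeasurable.sub hn.aemeasurable, C + D, fun x =>
    (abs_sub _ _).trans (add_le_add (hC x) (hD x))⟩

lemma IsBddMul.mul {m n : X → ℝ} (hm : IsBddMul m) (hn : IsBddMul n) :
    IsBddMul fun x => m x * n x := by
  obtain ⟨C, hC⟩ := hm.bdd
  obtain ⟨D, hD⟩ := hn.bdd
  refine ⟨hm.aemeasurable.mul hn.aemeasurable, C * D, fun x => ?_⟩
  rw [abs_mul]
  exact mul_le_mul (hC x) (hD x) (abs_nonneg _) ((abs_nonneg _).trans (hC x))

lemma IsBddMul.indicator {m : X → ℝ} (hm : IsBddMul m) {s : Set X}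
    (hs : NullMeasurableSet s volume) : IsBddMul (s.indicator m) := by
  obtain ⟨C, hC⟩ := hm.bdd
  refine ⟨hm.aemeasurable.indicator₀ hs, C, fun x => ?_⟩
  by_cases h : x ∈ s
  · simpa [h] using hC x
  · simpa [h] using (abs_nonneg _).trans (hC x)

lemma mulCLM_sub {m n : X → ℝ} (hm : IsBddMul m) (hn : IsBddMul n) :
    mulCLM m - mulCLM n = mulCLM fun x => m x - n x := by
  ext1 u
  refine Lp.ext ?_
  rw [sub_apply]
  filter_upwards [Lp.coeFn_sub (mulCLM m u) (mulCLM n u), coeFn_mulCLM hm u, coeFn_mulCLM hn u,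
    coeFn_mulCLM (hm.sub hn) u] with x h1 h2 h3 h4
  rw [h1, Pi.sub_apply, h2, h3, h4]
  push_cast
  ring

lemma inner_mulCLM_left {m : X → ℝ} (hm : IsBddMul m) (u v : L2 X) :
    inner ℂ (mulCLM m u) v = inner ℂ u (mulCLM m v) := by
  rw [L2.inner_def, L2.inner_def]
  refine integral_congr_ae ?_
  filter_upwards [coeFn_mulCLM hm u, coeFn_mulCLM hm v] with x h1 h2
  rw [h1, h2]
  simp only [RCLike.inner_apply, map_mul, Complex.conj_ofReal]
  ring

end Multiplication

/-! ### Carleman operators -/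

section Carleman

variable {X : Type*} [MeasureSpace X] {E : Type*} [NormedAddCommGroup E] [NormedSpace ℂ E]

/-- The Carleman operator `(T_Φ u)(x) = Φ(x) u` of a square-integrable family `Φ` of functionals,
as a continuous linear function of `Φ`. -/
def carlemanOp : Lp (E →L[ℂ] ℂ) 2 (volume : Measure X) →L[ℂ] E →L[ℂ] L2 X :=
  LinearMap.mkContinuous₂ (LinearMap.mk₂ ℂ
    (fun Φ u => (ContinuousLinearMap.apply ℂ ℂ u).compLp Φ)
    (fun Φ Ψ u => by exact map_add ((ContinuousLinearMap.apply ℂ ℂ u).compLpL 2 volume) Φ Ψ)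
    (fun c Φ u => by exact map_smul ((ContinuousLinearMap.apply ℂ ℂ u).compLpL 2 volume) c Φ)
    (fun Φ u v => by rw [map_add, ContinuousLinearMap.add_compLp])
    (fun c Φ u => by rw [map_smul, ContinuousLinearMap.smul_compLp])) 1 (by
    intro Φ u
    refine ((ContinuousLinearMap.apply ℂ ℂ u).norm_compLp_le Φ).trans ?_
    rw [one_mul, mul_comm]
    refine mul_le_mul_of_nonneg_left ?_ (norm_nonneg _)
    refine ContinuousLinearMap.opNorm_le_bound _ (norm_nonneg _) fun ψ => ?_
    rw [mul_comm]
    exact ψ.le_opNorm u)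

lemma coeFn_carlemanOp (Φ : Lp (E →L[ℂ] ℂ) 2 (volume : Measure X)) (u : E) :
    carlemanOp Φ u =ᵐ[volume] fun x => Φ x u :=
  (ContinuousLinearMap.apply ℂ ℂ u).coeFn_compLp Φ

/-- Carleman operators of square-integrable families are compact: simple families give operators
of finite rank. -/
lemma isCompactOperator_carlemanOp (Φ : Lp (E →L[ℂ] ℂ) 2 (volume : Measure X)) :
    IsCompactOperator (carlemanOp Φ) := by
  refine Lp.induction (p := 2) (by simp) (fun Φ => IsCompactOperator (carlemanOp Φ))
    ?_ ?_ ?_ Φ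
  · intro ψ s hs hμs
    let e : L2 X := indicatorConstLp 2 hs hμs.ne 1
    have h : carlemanOp (Lp.simpleFunc.indicatorConst 2 hs hμs.ne ψ :
        Lp (E →L[ℂ] ℂ) 2 (volume : Measure X)) = ψ.smulRight e := by
      ext1 u
      refine Lp.ext ?_
      rw [Lp.simpleFunc.coe_indicatorConst]
      refine (coeFn_carlemanOp _ u).trans ?_
      rw [ContinuousLinearMap.smulRight_apply]
      filter_upwards [indicatorConstLp_coeFn (p := 2) (hs := hs) (hμs := hμs.ne) (c := ψ),
        Lp.coeFn_smul (ψ u) e,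
        indicatorConstLp_coeFn (p := 2) (hs := hs) (hμs := hμs.ne) (c := (1 : ℂ))] with x h1 h2 h3
      rw [h1, h2, Pi.smul_apply, h3]
      by_cases hx : x ∈ s <;> simp [hx]
    rw [h]
    exact (isCompactOperator_of_locallyCompactSpace_dom ψ).clm_comp
      ((ContinuousLinearMap.id ℂ ℂ).smulRight e)
  · intro f g hf hg _ h1 h2
    rw [map_add]
    exact h1.add h2
  · exact isClosed_setOfPred_isCompactOperator.preimage carlemanOp.continuous

end Carleman

/-! ### The Fourier transform on `L¹ ∩ L²` -/

section Fourier

open FourierTransform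

variable {d : ℕ}

lemma continuous_fourier_of_integrable {f : Space d → ℂ} (hf : Integrable f volume) :
    Continuous (𝓕 f) :=
  VectorFourier.fourierIntegral_continuous Real.continuous_fourierChar
    (L := innerₗ (Space d)) continuous_inner hf

lemma integral_fourier_smul_eq {f g : Space d → ℂ} (hf : Integrable f volume)
    (hg : Integrable g volume) : ∫ ξ, 𝓕 f ξ • g ξ = ∫ x, f x • 𝓕 g x := by
  simpa using! VectorFourier.integral_fourierIntegral_smul_eq_flip (L := innerₗ (Space d))
    Real.continuous_fourierChar continuous_inner hf hg

/-- On `L¹ ∩ L²` the unitary Fourier transform is given by the Fourier integral. -/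
lemma coeFn_fourierL2 (f : L2 (Space d)) (hf : Integrable f volume) :
    fourierL2 d f =ᵐ[volume] 𝓕 (f : Space d → ℂ) := by
  refine ae_eq_of_integral_contDiff_smul_eq
    ((Lp.memLp _).locallyIntegrable (by norm_num))
    (continuous_fourier_of_integrable hf).locallyIntegrable fun g hg hgc => ?_
  let G : SchwartzMap (Space d) ℂ := HasCompactSupport.toSchwartzMap (f := fun x => (g x : ℂ))
    (hgc.comp_left (g := ((↑) : ℝ → ℂ)) Complex.ofReal_zero) (Complex.ofRealCLM.contDiff.comp hg)
  have hG : ∀ x, G x = (g x : ℂ) := fun x => rfl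
  have h1 : ∫ x, G x • (fourierL2 d f) x = ∫ x, (𝓕 G) x • f x := by
    rw [← Lp.toTemperedDistribution_apply, ← Lp.toTemperedDistribution_apply,
      ← TemperedDistribution.fourier_apply, Lp.fourier_toTemperedDistribution_eq]
    rfl
  have h2 : ∫ x, (𝓕 G) x • f x = ∫ x, G x • 𝓕 (f : Space d → ℂ) x := by
    rw [SchwartzMap.fourier_coe]
    exact integral_fourier_smul_eq G.integrable hf
  have h3 := h1.trans h2
  simpa only [hG, Complex.coe_smul] using h3

/-- On `L¹ ∩ L²` the inverse of the unitary Fourier transform is given by the inverse Fourier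
integral. -/
lemma coeFn_fourierL2_symm (f : L2 (Space d)) (hf : Integrable f volume) :
    (fourierL2 d).symm f =ᵐ[volume] 𝓕⁻ (f : Space d → ℂ) := by
  have hcont : Continuous (𝓕⁻ (f : Space d → ℂ)) := by
    have : 𝓕⁻ (f : Space d → ℂ) = fun x => 𝓕 (f : Space d → ℂ) (-x) :=
      funext fun x => Real.fourierInv_eq_fourier_neg _ x
    rw [this]
    exact (continuous_fourier_of_integrable hf).comp continuous_neg
  refine ae_eq_of_integral_contDiff_smul_eq
    ((Lp.memLp _).locallyIntegrable (by norm_num)) hcont.locallyIntegrable fun g hg hgc => ?_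
  let G : SchwartzMap (Space d) ℂ := HasCompactSupport.toSchwartzMap (f := fun x => (g x : ℂ))
    (hgc.comp_left (g := ((↑) : ℝ → ℂ)) Complex.ofReal_zero) (Complex.ofRealCLM.contDiff.comp hg)
  have hG : ∀ x, G x = (g x : ℂ) := fun x => rfl
  have h1 : ∫ x, G x • ((fourierL2 d).symm f) x = ∫ x, (𝓕⁻ G) x • f x := by
    rw [← Lp.toTemperedDistribution_apply, ← Lp.toTemperedDistribution_apply,
      ← TemperedDistribution.fourierInv_apply, Lp.fourierInv_toTemperedDistribution_eq]
    rfl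
  have h2 : ∫ x, (𝓕⁻ G) x • f x = ∫ x, G x • 𝓕⁻ (f : Space d → ℂ) x := by
    rw [SchwartzMap.fourierInv_coe]
    simp only [Real.fourierInv_eq_fourier_neg]
    have h := integral_fourier_smul_eq G.integrable (f := G) (g := fun x => f (-x)) hf.comp_neg
    rw [← integral_neg_eq_self]
    simp only [neg_neg]
    rw [h]
    refine integral_congr_ae (ae_of_all _ fun x => ?_)
    simp only [← Real.fourierInv_eq_fourier_neg, Real.fourierInv_eq_fourier_comp_neg]
  have h3 := h1.trans h2
  simpa only [hG, Complex.coe_smul] using h3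

end Fourier

/-! ### Compactness of `w(x) m(-i∇)` -/

section Compactness

open FourierTransform

variable {d : ℕ}

/-- The operator `w(x) m(-i∇)`, where `m` is a function of the frequency `ξ = k / 2π`. -/
def potMul (w m : Space d → ℝ) : L2 (Space d) →L[ℂ] L2 (Space d) :=
  mulCLM w ∘L ((fourierL2 d).symm : L2 (Space d) →L[ℂ] L2 (Space d)) ∘L mulCLM m

lemma potMul_apply (w m : Space d → ℝ) (u : L2 (Space d)) :
    potMul w m u = mulCLM w ((fourierL2 d).symm (mulCLM m u)) := rfl

lemma norm_comp_fourier_comp_le (A B : L2 (Space d) →L[ℂ] L2 (Space d)) :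
    ‖A ∘L ((fourierL2 d).symm : L2 (Space d) →L[ℂ] L2 (Space d)) ∘L B‖ ≤ ‖A‖ * ‖B‖ := by
  refine ContinuousLinearMap.opNorm_le_bound _ (by positivity) fun u => ?_
  refine (A.le_opNorm _).trans ?_
  rw [mul_assoc]
  refine mul_le_mul_of_nonneg_left ?_ (norm_nonneg _)
  exact ((fourierL2 d).symm.norm_map _).le.trans (B.le_opNorm u)

lemma norm_potMul_le (w m : Space d → ℝ) : ‖potMul w m‖ ≤ ‖mulCLM w‖ * ‖mulCLM m‖ :=
  norm_comp_fourier_comp_le _ _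

lemma potMul_sub_left (w w' m : Space d → ℝ) :
    potMul w m - potMul w' m = (mulCLM w - mulCLM w') ∘L
      ((fourierL2 d).symm : L2 (Space d) →L[ℂ] L2 (Space d)) ∘L mulCLM m := by
  simp only [potMul, ContinuousLinearMap.sub_comp]

/-- The function `ξ ↦ e^{-2πi⟨ξ, x⟩} m(ξ)`. -/
def planeWave (m : Space d → ℝ) (x ξ : Space d) : ℂ :=
  Complex.exp (((-2 * Real.pi * inner ℝ ξ x : ℝ) : ℂ) * Complex.I) * (m ξ : ℂ)

lemma memLp_planeWave {m : Space d → ℝ} (hm : MemLp (fun ξ => (m ξ : ℂ)) 2 volume) (x : Space d) :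
    MemLp (planeWave m x) 2 volume := by
  refine hm.of_le (AEStronglyMeasurable.mul ?_ hm.1) (ae_of_all _ fun ξ => ?_)
  · exact Continuous.aestronglyMeasurable (by fun_prop)
  · rw [planeWave, norm_mul, Complex.norm_exp_ofReal_mul_I, one_mul]

lemma norm_exp_mul_I_sub_le (s t : ℝ) :
    ‖Complex.exp ((s : ℂ) * Complex.I) - Complex.exp ((t : ℂ) * Complex.I)‖ ≤ |s - t| := by
  have h : Complex.exp ((s : ℂ) * Complex.I) - Complex.exp ((t : ℂ) * Complex.I) =
      Complex.exp ((t : ℂ) * Complex.I) *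
        (Complex.exp (Complex.I * ((s - t : ℝ) : ℂ)) - 1) := by
    rw [mul_sub, mul_one, ← Complex.exp_add]
    congr 2
    push_cast
    ring
  rw [h, norm_mul, Complex.norm_exp_ofReal_mul_I, one_mul]
  exact (Real.norm_exp_I_mul_ofReal_sub_one_le).trans (Real.norm_eq_abs _).le

/-- For `m` of bounded support, the plane waves cut off by `m` depend continuously on `x`. -/
lemma continuous_planeWave {m : Space d → ℝ} (hm : MemLp (fun ξ => (m ξ : ℂ)) 2 volume)
    {n : ℝ} (hn : ∀ ξ, n < ‖ξ‖ → m ξ = 0) :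
    Continuous fun x => (memLp_planeWave hm x).toLp := by
  have h0 : ∀ x y, ‖(memLp_planeWave hm x).toLp - (memLp_planeWave hm y).toLp‖ ≤
      (2 * Real.pi * |n| * ‖x - y‖) * ‖hm.toLp‖ := by
    intro x y
    rw [← MemLp.toLp_sub]
    refine Lp.norm_le_mul_norm_of_ae_le_mul ?_
    filter_upwards [((memLp_planeWave hm x).sub (memLp_planeWave hm y)).coeFn_toLp,
      hm.coeFn_toLp] with ξ h1 h2
    rw [h1, h2, Pi.sub_apply, planeWave, planeWave, ← sub_mul, norm_mul]
    by_cases hξ : n < ‖ξ‖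
    · simp [hn ξ hξ]
    · refine mul_le_mul_of_nonneg_right ((norm_exp_mul_I_sub_le _ _).trans ?_) (norm_nonneg _)
      rw [← mul_sub, ← inner_sub_right, abs_mul, abs_mul, abs_neg, abs_two,
        abs_of_pos Real.pi_pos, mul_assoc (2 * Real.pi)]
      refine mul_le_mul_of_nonneg_left ((abs_real_inner_le_norm _ _).trans ?_) (by positivity)
      exact mul_le_mul_of_nonneg_right ((not_lt.1 hξ).trans (le_abs_self n)) (norm_nonneg _)
  refine (LipschitzWith.of_dist_le_mul
    (K := Real.toNNReal (2 * Real.pi * |n| * ‖hm.toLp‖)) fun x y => ?_).continuous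
  rw [dist_eq_norm, dist_eq_norm, Real.coe_toNNReal _ (by positivity)]
  exact (h0 x y).trans (by apply le_of_eq; ring)

lemma isCompactOperator_potMul_of_bounded_support {w m : Space d → ℝ} (hw : IsBddMul w)
    (hw2 : MemLp w 2 volume) (hm : IsBddMul m) {n : ℝ} (hn : ∀ ξ, n < ‖ξ‖ → m ξ = 0) :
    IsCompactOperator (potMul w m) := by
  obtain ⟨C, hC⟩ := hm.bdd
  have hmm : AEStronglyMeasurable (fun ξ => (m ξ : ℂ)) volume :=
    (Complex.measurable_ofReal.comp_aemeasurable hm.aemeasurable).aestronglyMeasurable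
  have hm2 : MemLp (fun ξ => (m ξ : ℂ)) 2 volume := by
    have h1 : MemLp ((Metric.closedBall (0 : Space d) n).indicator fun _ => C) 2 volume :=
      memLp_indicator_const 2 measurableSet_closedBall C
        (Or.inr measure_closedBall_lt_top.ne)
    refine h1.of_le hmm (ae_of_all _ fun ξ => ?_)
    by_cases hξ : n < ‖ξ‖
    · simp [hn ξ hξ]
    · rw [Set.indicator_of_mem (by simpa using not_lt.1 hξ), Complex.norm_real]
      exact (hC ξ).trans (le_abs_self C)
  -- the functional `u ↦ w(x) (𝓕⁻¹ (m u))(x)` is an inner product with a plane wave cut off by `m`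
  let Φ : Space d → (L2 (Space d) →L[ℂ] ℂ) := fun x =>
    (w x : ℂ) • innerSL ℂ (memLp_planeWave hm2 x).toLp
  have hΦ : MemLp Φ 2 volume := by
    have hc : Continuous fun x => innerSL ℂ (memLp_planeWave hm2 x).toLp :=
      (innerSL ℂ).continuous.comp (continuous_planeWave hm2 hn)
    refine hw2.of_le_mul (c := ‖hm2.toLp‖) (AEStronglyMeasurable.smul
      (Complex.measurable_ofReal.comp_aemeasurable hw.aemeasurable).aestronglyMeasurable
        hc.aestronglyMeasurable) (ae_of_all _ fun x => ?_)
    rw [norm_smul, innerSL_apply_norm, Complex.norm_real, mul_comm]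
    refine mul_le_mul_of_nonneg_right ?_ (norm_nonneg _)
    refine (Lp.norm_le_mul_norm_of_ae_le_mul (c := 1) ?_).trans (one_mul _).le
    filter_upwards [(memLp_planeWave hm2 x).coeFn_toLp, hm2.coeFn_toLp] with ξ h1 h2
    rw [h1, h2, planeWave, norm_mul, Complex.norm_exp_ofReal_mul_I]
  have hrep : potMul w m = carlemanOp hΦ.toLp := by
    ext1 u
    have hint : Integrable (mulCLM m u) volume := by
      refine (memLp_one_iff_integrable.1
        ((Lp.memLp u).mul (r := 1) hm2)).congr ?_
      filter_upwards [coeFn_mulCLM hm u] with ξ h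
      rw [h]
      rfl
    refine Lp.ext ?_
    filter_upwards [coeFn_carlemanOp hΦ.toLp u, hΦ.coeFn_toLp,
      coeFn_mulCLM hw ((fourierL2 d).symm (mulCLM m u)), coeFn_fourierL2_symm _ hint]
      with x h1 h2 h3 h4
    rw [h1, h2, potMul_apply, h3, h4]
    simp only [Φ, smul_apply, innerSL_apply_apply, smul_eq_mul]
    congr 1
    rw [Real.fourierInv_eq', L2.inner_def]
    refine integral_congr_ae ?_
    filter_upwards [coeFn_mulCLM hm u, (memLp_planeWave hm2 x).coeFn_toLp] with ξ h5 h6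
    rw [h5, h6, RCLike.inner_apply, planeWave, map_mul, Complex.conj_ofReal, ← Complex.exp_conj,
      map_mul, Complex.conj_I, Complex.conj_ofReal, smul_eq_mul]
    have : ((-2 * Real.pi * inner ℝ ξ x : ℝ) : ℂ) * -Complex.I =
        ((2 * Real.pi * inner ℝ ξ x : ℝ) : ℂ) * Complex.I := by
      push_cast
      ring
    rw [this]
    ring
  rw [hrep]
  exact isCompactOperator_carlemanOp _

/-- Cutting off a bounded function vanishing at infinity changes it by little. -/
lemma tendsto_mulCLM_cutoff {m : Space d → ℝ} (hm : IsBddMul m)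
    (h0 : Tendsto m (cocompact (Space d)) (𝓝 0)) :
    Tendsto (fun n : ℕ => mulCLM ((Metric.closedBall (0 : Space d) n).indicator m)) atTop
      (𝓝 (mulCLM m)) := by
  rw [Metric.tendsto_atTop]
  intro ε hε
  have h1 : ∀ᶠ x in cocompact (Space d), |m x| < ε / 2 := by
    have := (tendsto_order.1 h0.abs).2 (ε / 2) (by simpa using hε)
    simpa using this
  rw [← Metric.cobounded_eq_cocompact, ← comap_norm_atTop, eventually_comap, eventually_atTop] at h1
  obtain ⟨r, hr⟩ := h1
  obtain ⟨N, hN⟩ := exists_nat_ge r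
  refine ⟨N, fun n hn => ?_⟩
  have hind := hm.indicator
    (measurableSet_closedBall (x := (0 : Space d)) (ε := (n : ℝ))).nullMeasurableSet
  rw [dist_eq_norm, mulCLM_sub hind hm]
  refine lt_of_le_of_lt (norm_mulCLM_le (hind.sub hm).aemeasurable (half_pos hε).le
    fun x => ?_) (half_lt_self hε)
  by_cases hx : x ∈ Metric.closedBall (0 : Space d) n
  · simpa [hx] using (half_pos hε).le
  · have hxr : r ≤ ‖x‖ := by
      rw [mem_closedBall_zero_iff, not_le] at hx
      exact (hN.trans (by exact_mod_cast hn)).trans hx.le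
    simpa [hx] using (hr _ hxr x rfl).le

lemma isCompactOperator_potMul_of_memLp {w m : Space d → ℝ} (hw : IsBddMul w)
    (hw2 : MemLp w 2 volume) (hm : IsBddMul m)
    (h0 : Tendsto m (cocompact (Space d)) (𝓝 0)) : IsCompactOperator (potMul w m) := by
  refine isCompactOperator_of_tendsto (l := atTop)
    (F := fun n : ℕ => potMul w ((Metric.closedBall (0 : Space d) n).indicator m)) ?_
    (Eventually.of_forall fun n => isCompactOperator_potMul_of_bounded_support hw hw2
      (hm.indicator measurableSet_closedBall.nullMeasurableSet) (n := n) fun ξ hξ => ?_)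
  · exact ((continuous_const.clm_comp (continuous_const.clm_comp continuous_id)).tendsto
      _).comp (tendsto_mulCLM_cutoff hm h0)
  · exact Set.indicator_of_notMem (by simpa using hξ) _

lemma isCompactOperator_potMul_of_tendsto {w m : Space d → ℝ} (hw : IsBddMul w)
    (hw0 : Tendsto w (cocompact (Space d)) (𝓝 0)) (hm : IsBddMul m)
    (h0 : Tendsto m (cocompact (Space d)) (𝓝 0)) : IsCompactOperator (potMul w m) := by
  refine isCompactOperator_of_tendsto (l := atTop)
    (F := fun n : ℕ => potMul ((Metric.closedBall (0 : Space d) n).indicator w) m) ?_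
    (Eventually.of_forall fun n => isCompactOperator_potMul_of_memLp
      (hw.indicator measurableSet_closedBall.nullMeasurableSet) ?_ hm h0)
  · exact ((continuous_id.clm_comp continuous_const).tendsto _).comp
      (tendsto_mulCLM_cutoff hw hw0)
  · obtain ⟨C, hC⟩ := hw.bdd
    have h1 : MemLp ((Metric.closedBall (0 : Space d) n).indicator fun _ => C) 2 volume :=
      memLp_indicator_const 2 measurableSet_closedBall C
        (Or.inr measure_closedBall_lt_top.ne)
    refine h1.of_le (hw.indicator
      measurableSet_closedBall.nullMeasurableSet).aemeasurable.aestronglyMeasurable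
      (ae_of_all _ fun x => ?_)
    by_cases hx : x ∈ Metric.closedBall (0 : Space d) n
    · rw [Set.indicator_of_mem hx, Set.indicator_of_mem hx]
      exact (hC x).trans (le_abs_self C)
    · rw [Set.indicator_of_notMem hx, Set.indicator_of_notMem hx]

end Compactness

/-! ### Bounded symmetric perturbations -/

section Perturbation

variable {E : Type*} [NormedAddCommGroup E] [InnerProductSpace ℂ E] [CompleteSpace E]

/-- If `S` is the resolvent at `-c` of an operator `A ≥ 0` and `W` is a small symmetric
perturbation with `W S` compact, then the spectrum of `A - W` is discrete in `(-c, 0)`. -/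
theorem discrete_spec_of_bounded_perturbation {G : Submodule ℂ (E × E)} {c μ : ℝ} (hμ : μ < 0)
    (hc : -μ < c) {S W : E →L[ℂ] E}
    (hG : ∀ u g : E, (u, g + (-c : ℂ) • u) ∈ G ↔ u = S (g + W u))
    (hSs : ∀ u v : E, inner ℂ (S u) v = inner ℂ u (S v))
    (hWs : ∀ u v : E, inner ℂ (W u) v = inner ℂ u (W v)) (hS : ‖S‖ ≤ 1 / c)
    (hSW : ‖S‖ * ‖W‖ < 1) (hK : IsCompactOperator (W * S)) (hspec : (μ : ℂ) ∈ spec G) :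
    (∀ᶠ z in 𝓝[≠] (μ : ℂ), z ∉ spec G) ∧
      eigenspaceOf G μ ≠ ⊥ ∧ FiniteDimensional ℂ (eigenspaceOf G μ) := by
  obtain ⟨U, hU⟩ : IsUnit (1 - S * W) :=
    isUnit_one_sub_of_norm_lt_one ((norm_mul_le _ _).trans_lt hSW)
  let R : E →L[ℂ] E := (↑U⁻¹ : E →L[ℂ] E) * S
  have hR : ∀ u g, u = S (g + W u) ↔ u = R g := by
    intro u g
    have h0 : u = S (g + W u) ↔ (U : E →L[ℂ] E) u = S g := by
      rw [hU, map_add, ← sub_eq_iff_eq_add]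
      rfl
    rw [h0]
    constructor
    · intro h
      rw [mul_apply_eq_comp, ← h, ← mul_apply_eq_comp, Units.inv_mul, one_apply_eq_self]
    · intro h
      rw [h, mul_apply_eq_comp, ← mul_apply_eq_comp, Units.mul_inv, one_apply_eq_self]
  have hq : ∀ g, R g = S (g + W (R g)) := fun g => (hR _ g).2 rfl
  refine discrete_spec_of_resolvent hμ hc (R := R) (S := S) (K := R * (W * S))
    (fun u g => (hG u g).trans (hR u g)) ?_ ?_ hS (hK.clm_comp R) hspec
  · -- the second resolvent identity
    have h : (↑U⁻¹ : E →L[ℂ] E) * (1 - S * W) = 1 := by rw [← hU, Units.inv_mul]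
    have h2 : R - R * (W * S) = (↑U⁻¹ : E →L[ℂ] E) * (1 - S * W) * S := by
      simp only [R]
      noncomm_ring
    rw [h, one_mul] at h2
    exact sub_eq_iff_eq_add.1 h2
  · intro f g
    have h1 : inner ℂ (R f) (g + W (R g)) = inner ℂ (f + W (R f)) (R g) := by
      have h := hSs (f + W (R f)) (g + W (R g))
      rwa [← hq f, ← hq g] at h
    rw [inner_add_right, inner_add_left, hWs] at h1
    exact add_right_cancel h1

end Perturbation

/-! ### Fourier multipliers with a bounded potential -/

section Multiplier

variable {X : Type*} [MeasureSpace X]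

lemma isBddMul_inv_add {b : X → ℝ} (hb : AEMeasurable b volume) (hb0 : ∀ x, 0 ≤ b x) {c : ℝ}
    (hc : 0 < c) : IsBddMul fun x => (b x + c)⁻¹ := by
  refine ⟨(hb.add_const c).inv, c⁻¹, fun x => ?_⟩
  have := hb0 x
  rw [abs_of_nonneg (by positivity)]
  exact inv_anti₀ hc (by linarith)

lemma coeFn_mulOp {m : X → ℝ} {u : L2 X} (h : u ∈ (mulOp m).domain) :
    mulOp m ⟨u, h⟩ =ᵐ[volume] fun x => (m x : ℂ) * u x :=
  MemLp.coeFn_toLp h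

/-- The operator `(b + c)⁻¹` is the resolvent at `-c` of multiplication by `b ≥ 0`. -/
lemma mulOp_add_smul_eq_iff {b : X → ℝ} (hb : AEMeasurable b volume) (hb0 : ∀ x, 0 ≤ b x) {c : ℝ}
    (hc : 0 < c) (u f : L2 X) :
    (∃ h : u ∈ (mulOp b).domain, mulOp b ⟨u, h⟩ + (c : ℂ) • u = f) ↔
      u = mulCLM (fun x => (b x + c)⁻¹) f := by
  have hm := isBddMul_inv_add hb hb0 hc
  have hne : ∀ x, ((b x : ℂ) + c) ≠ 0 := by
    intro x
    have := hb0 x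
    norm_cast
    positivity
  constructor
  · rintro ⟨h, hf⟩
    refine Lp.ext ?_
    filter_upwards [coeFn_mulCLM hm f, coeFn_mulOp h, Lp.coeFn_add (mulOp b ⟨u, h⟩) ((c : ℂ) • u),
      Lp.coeFn_smul (c : ℂ) u] with x h2 h3 h4 h5
    rw [h2, ← hf, h4, Pi.add_apply, h3, h5, Pi.smul_apply, smul_eq_mul]
    push_cast
    rw [← add_mul, inv_mul_cancel_left₀ (hne x)]
  · intro hu
    have hu' : u =ᵐ[volume] fun x => (((b x + c)⁻¹ : ℝ) : ℂ) * f x := hu ▸ coeFn_mulCLM hm f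
    have h : MemLp (fun x => (b x : ℂ) * u x) 2 volume := by
      refine (Lp.memLp f).of_le ((Complex.measurable_ofReal.comp_aemeasurable
        hb).aestronglyMeasurable.mul (Lp.aestronglyMeasurable u)) ?_
      filter_upwards [hu'] with x hx
      have := hb0 x
      rw [hx, ← mul_assoc, ← Complex.ofReal_mul, norm_mul, Complex.norm_real, Real.norm_eq_abs,
        abs_of_nonneg (by positivity)]
      refine mul_le_of_le_one_left (norm_nonneg _) ?_
      rw [← div_eq_mul_inv, div_le_one (by positivity)]
      linarith
    refine ⟨h, Lp.ext ?_⟩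
    filter_upwards [hu', coeFn_mulOp h, Lp.coeFn_add (mulOp b ⟨u, h⟩) ((c : ℂ) • u),
      Lp.coeFn_smul (c : ℂ) u] with x h2 h3 h4 h5
    rw [h4, Pi.add_apply, h3, h5, Pi.smul_apply, smul_eq_mul, h2]
    push_cast
    rw [← add_mul, mul_inv_cancel_left₀ (hne x)]

variable {d : ℕ}

/-- The bounded Fourier multiplier with symbol `m`, in the frequency variable `ξ = k / 2π`. -/
def multCLM (m : Space d → ℝ) : L2 (Space d) →L[ℂ] L2 (Space d) :=
  ((fourierL2 d).symm : L2 (Space d) →L[ℂ] L2 (Space d)) ∘L mulCLM m ∘L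
    (fourierL2 d : L2 (Space d) →L[ℂ] L2 (Space d))

lemma multCLM_apply (m : Space d → ℝ) (u : L2 (Space d)) :
    multCLM m u = (fourierL2 d).symm (mulCLM m (fourierL2 d u)) := rfl

lemma norm_multCLM_le (m : Space d → ℝ) : ‖multCLM m‖ ≤ ‖mulCLM m‖ := by
  refine ContinuousLinearMap.opNorm_le_bound _ (norm_nonneg _) fun u => ?_
  rw [multCLM_apply, LinearIsometryEquiv.norm_map]
  refine ((mulCLM m).le_opNorm _).trans ?_
  rw [LinearIsometryEquiv.norm_map]

lemma inner_multCLM_left {m : Space d → ℝ} (hm : IsBddMul m) (u v : L2 (Space d)) :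
    inner ℂ (multCLM m u) v = inner ℂ u (multCLM m v) := by
  rw [multCLM_apply, multCLM_apply, ← (fourierL2 d).inner_map_map,
    LinearIsometryEquiv.apply_symm_apply, inner_mulCLM_left hm,
    ← (fourierL2 d).inner_map_map u, LinearIsometryEquiv.apply_symm_apply]

lemma fourierL2_fourierOp {a : Space d → ℝ} (u : L2 (Space d)) (h : u ∈ (fourierOp a).domain) :
    fourierL2 d (fourierOp a ⟨u, h⟩) =
      (mulOp fun ξ => a ((2 * Real.pi) • ξ)) ⟨fourierL2 d u, h⟩ :=
  (fourierL2 d).apply_symm_apply _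

lemma fourierOp_add_smul_eq_iff {a : Space d → ℝ} (ha : Measurable a) (ha0 : ∀ k, 0 ≤ a k) {c : ℝ}
    (hc : 0 < c) (u f : L2 (Space d)) :
    (∃ h : u ∈ (fourierOp a).domain, fourierOp a ⟨u, h⟩ + (c : ℂ) • u = f) ↔
      u = multCLM (fun ξ => (a ((2 * Real.pi) • ξ) + c)⁻¹) f := by
  rw [multCLM_apply, LinearIsometryEquiv.eq_symm_apply,
    ← mulOp_add_smul_eq_iff (b := fun ξ => a ((2 * Real.pi) • ξ))
      (ha.comp (measurable_const_smul (2 * Real.pi))).aemeasurable (fun ξ => ha0 _) hc]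
  refine exists_congr fun h => ?_
  rw [← fourierL2_fourierOp, ← map_smul, ← map_add]
  exact ((fourierL2 d).injective.eq_iff).symm

lemma mem_graph_multiplier_sub_potential {a V : Space d → ℝ} {σ : ℝ} (hV : IsBddMul V)
    (u w : L2 (Space d)) :
    (u, w) ∈ (fourierOp a - (σ : ℂ) • mulOp V).graph ↔
      ∃ h : u ∈ (fourierOp a).domain, fourierOp a ⟨u, h⟩ - mulCLM (fun x => σ * V x) u = w := by
  have hw : IsBddMul fun x => σ * V x := by
    obtain ⟨M, hM⟩ := hV.bdd
    refine ⟨hV.aemeasurable.const_mul σ, |σ| * M, fun x => ?_⟩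
    rw [abs_mul]
    exact mul_le_mul_of_nonneg_left (hM x) (abs_nonneg σ)
  have hVdom : u ∈ (mulOp V).domain := hV.memLp (Lp.memLp u)
  have hVW : (σ : ℂ) • mulOp V ⟨u, hVdom⟩ = mulCLM (fun x => σ * V x) u := by
    refine Lp.ext ?_
    filter_upwards [coeFn_mulOp hVdom, Lp.coeFn_smul (σ : ℂ) (mulOp V ⟨u, hVdom⟩), coeFn_mulCLM hw u]
      with x h2 h3 h4
    rw [h3, h4, Pi.smul_apply, h2, smul_eq_mul]
    push_cast
    ring
  rw [LinearPMap.mem_graph_iff, ← hVW]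
  constructor
  · rintro ⟨⟨y, hy⟩, h1, h2⟩
    obtain rfl : y = u := h1
    exact ⟨hy.1, h2⟩
  · rintro ⟨h, h1⟩
    exact ⟨⟨u, h, hVdom⟩, rfl, h1⟩

/-- The negative spectrum of `A - σ V` is discrete for a nonnegative multiplier `A` tending to
infinity and a bounded potential vanishing at infinity. -/
theorem discrete_multiplier_sub_potential {a V : Space d → ℝ} {σ M : ℝ} (ha : Measurable a)
    (ha0 : ∀ k, 0 ≤ a k) (ha1 : Tendsto a (cocompact (Space d)) atTop)
    (hV : AEMeasurable V volume) (hM : ∀ x, |V x| ≤ M)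
    (hV0 : Tendsto V (cocompact (Space d)) (𝓝 0)) (hσ : 0 < σ) :
    HasDiscreteNegativeSpectrum (fourierOp a - (σ : ℂ) • mulOp V).graph := by
  intro μ hμ hspec
  have hM0 : 0 ≤ M := (abs_nonneg _).trans (hM 0)
  -- `c > σ M` makes the Neumann series converge, `c > -μ` puts `μ` into `(-c, 0)`
  obtain ⟨c, hc⟩ : ∃ c : ℝ, c = -μ + σ * M + 1 := ⟨_, rfl⟩
  have hσM : 0 ≤ σ * M := by positivity
  have hc0 : 0 < c := by linarith
  let m : Space d → ℝ := fun ξ => (a ((2 * Real.pi) • ξ) + c)⁻¹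
  have ham : Measurable fun ξ : Space d => a ((2 * Real.pi) • ξ) :=
    ha.comp (measurable_const_smul (2 * Real.pi))
  have hm : IsBddMul m := isBddMul_inv_add ham.aemeasurable (fun ξ => ha0 _) hc0
  have hm0 : Tendsto m (cocompact (Space d)) (𝓝 0) := by
    refine tendsto_inv_atTop_zero.comp (tendsto_atTop_add_const_right _ _ (ha1.comp ?_))
    exact (Homeomorph.smulOfNeZero (2 * Real.pi) (by positivity)).isClosedEmbedding.tendsto_cocompact
  have hσV : ∀ x, |σ * V x| ≤ σ * M := fun x => by
    rw [abs_mul, abs_of_pos hσ]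
    exact mul_le_mul_of_nonneg_left (hM x) hσ.le
  have hw : IsBddMul fun x => σ * V x := ⟨hV.const_mul σ, σ * M, hσV⟩
  let S : L2 (Space d) →L[ℂ] L2 (Space d) := multCLM m
  let W : L2 (Space d) →L[ℂ] L2 (Space d) := mulCLM fun x => σ * V x
  have hS : ‖S‖ ≤ 1 / c := by
    refine (norm_multCLM_le m).trans (norm_mulCLM_le hm.aemeasurable (by positivity) fun ξ => ?_)
    have := ha0 ((2 * Real.pi) • ξ)
    rw [abs_of_nonneg (by positivity), one_div]
    exact inv_anti₀ hc0 (by linarith)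
  have hSW : ‖S‖ * ‖W‖ < 1 := by
    have hW : ‖W‖ ≤ σ * M := norm_mulCLM_le hw.aemeasurable hσM hσV
    calc ‖S‖ * ‖W‖ ≤ 1 / c * (σ * M) := by gcongr
      _ < 1 := by rw [one_div_mul_eq_div, div_lt_one hc0]; linarith
  refine discrete_spec_of_bounded_perturbation hμ (c := c) (by linarith) (S := S) (W := W)
    (fun u g => ?_) (inner_multCLM_left hm) (inner_mulCLM_left hw) hS hSW ?_ hspec
  · rw [mem_graph_multiplier_sub_potential ⟨hV, M, hM⟩, ← fourierOp_add_smul_eq_iff ha ha0 hc0]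
    refine exists_congr fun h => ?_
    rw [sub_eq_iff_eq_add, neg_smul, ← sub_eq_add_neg, sub_add_eq_add_sub, eq_sub_iff_add_eq]
  · have h : IsCompactOperator (potMul (fun x => σ * V x) m) :=
      isCompactOperator_potMul_of_tendsto hw (by simpa using hV0.const_mul σ) hm hm0
    exact h.comp_clm (fourierL2 d : L2 (Space d) →L[ℂ] L2 (Space d))

/-- A continuous function positive away from the origin of `ℝ^d`, `d ≥ 1`, is nonnegative. -/
lemma nonneg_of_continuous_of_pos {d : ℕ} (hd : 1 ≤ d) {a : Space d → ℝ} (ha : Continuous a)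
    (hpos : ∀ k, k ≠ 0 → 0 < a k) (k : Space d) : 0 ≤ a k := by
  have : Nonempty (Fin d) := ⟨⟨0, hd⟩⟩
  rcases eq_or_ne k 0 with rfl | hk
  · have h : Tendsto a (𝓝[≠] 0) (𝓝 (a 0)) := ha.continuousAt.tendsto.mono_left nhdsWithin_le_nhds
    refine ge_of_tendsto h ?_
    filter_upwards [self_mem_nhdsWithin] with k hk
    exact (hpos k hk).le
  · exact (hpos k hk).le

end Multiplier

/-! ### The heat kernel in the plane -/

section HeatKernel

open FourierTransform ENNReal

/-- The heat kernel on `ℝ²`. -/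
def heatKernel (t : ℝ) (z : Space 2) : ℝ := (4 * Real.pi * t)⁻¹ * Real.exp (-‖z‖ ^ 2 / (4 * t))

lemma heatKernel_nonneg {t : ℝ} (ht : 0 ≤ t) (z : Space 2) : 0 ≤ heatKernel t z := by
  unfold heatKernel
  positivity

lemma heatKernel_le {t : ℝ} (ht : 0 < t) (z : Space 2) : heatKernel t z ≤ (4 * Real.pi * t)⁻¹ := by
  unfold heatKernel
  refine mul_le_of_le_one_right (by positivity) (Real.exp_le_one_iff.2 ?_)
  rw [neg_div]
  exact neg_nonpos.2 (by positivity)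

lemma measurable_heatKernel_uncurry :
    Measurable fun p : ℝ × Space 2 => heatKernel p.1 p.2 := by
  unfold heatKernel
  fun_prop

lemma heatKernel_sub_comm (t : ℝ) (x y : Space 2) : heatKernel t (x - y) = heatKernel t (y - x) := by
  rw [heatKernel, heatKernel, norm_sub_rev]

lemma lintegral_heatKernel {t : ℝ} (ht : 0 < t) (x : Space 2) :
    ∫⁻ y, ENNReal.ofReal (heatKernel t (x - y)) = 1 := by
  rw [lintegral_sub_left_eq_self (fun z => ENNReal.ofReal (heatKernel t z)) x]
  have hb : 0 < (4 * t)⁻¹ := by positivity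
  have h1 : ∀ z : Space 2, heatKernel t z =
      (4 * Real.pi * t)⁻¹ * Real.exp (-(4 * t)⁻¹ * ‖z‖ ^ 2) := by
    intro z
    rw [heatKernel]
    congr 2
    ring
  have h2 := GaussianFourier.integral_rexp_neg_mul_sq_norm (V := Space 2) hb
  have h3 : ∫ z : Space 2, heatKernel t z = 1 := by
    simp only [h1]
    rw [integral_const_mul, h2]
    simp
    field_simp
  have hint : Integrable (fun z : Space 2 => heatKernel t z) volume :=
    integrable_of_integral_eq_one h3
  rw [← ofReal_integral_eq_lintegral_ofReal hint
    (ae_of_all _ fun z => heatKernel_nonneg ht.le z), h3, ENNReal.ofReal_one]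

lemma conj_fourier {d : ℕ} (F : Space d → ℂ) (ξ : Space d) :
    starRingEnd ℂ (𝓕 F ξ) = 𝓕 (fun y => starRingEnd ℂ (F (-y))) ξ := by
  rw [Real.fourier_eq', Real.fourier_eq', ← integral_conj, ← integral_neg_eq_self]
  refine integral_congr_ae (ae_of_all _ fun v => ?_)
  simp only [smul_eq_mul, map_mul, ← Complex.exp_conj, Complex.conj_I, Complex.conj_ofReal,
    inner_neg_left]
  congr 2
  push_cast
  ring

lemma fourier_heat_planeWave {t : ℝ} (ht : 0 < t) (x y : Space 2) :
    𝓕 (fun ξ : Space 2 => Complex.exp (-((4 * Real.pi ^ 2 * t : ℝ) : ℂ) * ‖ξ‖ ^ 2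
      + 2 * Real.pi * Complex.I * (inner ℝ (-x) ξ : ℝ))) y = (heatKernel t (x + y) : ℂ) := by
  have hb : 0 < (((4 * Real.pi ^ 2 * t : ℝ) : ℂ)).re := by
    rw [Complex.ofReal_re]
    positivity
  rw [fourier_gaussian_innerProductSpace' hb, heatKernel]
  have h1 : ‖-x - y‖ = ‖x + y‖ := by rw [← norm_neg]; congr 1; abel
  have hpi : (Real.pi : ℂ) ≠ 0 := by exact_mod_cast Real.pi_ne_zero
  have ht' : (t : ℂ) ≠ 0 := by exact_mod_cast ht.ne'
  rw [h1]
  simp only [finrank_euclideanSpace, Fintype.card_fin, Nat.cast_ofNat]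
  rw [div_self (two_ne_zero), Complex.cpow_one]
  push_cast
  congr 1
  · field_simp
  · congr 1
    field_simp

/-- The Gaussian weighted norm of a Fourier transform, in terms of the heat kernel. -/
lemma integral_gaussian_mul_fourier {F : Space 2 → ℂ} (hF : Integrable F volume) {t : ℝ}
    (ht : 0 < t) :
    ∫ ξ, ((Real.exp (-(4 * Real.pi ^ 2 * t) * ‖ξ‖ ^ 2) * ‖𝓕 F ξ‖ ^ 2 : ℝ) : ℂ) =
      ∫ x, F x * ∫ y, starRingEnd ℂ (F y) * (heatKernel t (x - y) : ℂ) := by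
  have hb : 0 < 4 * Real.pi ^ 2 * t := by positivity
  have hF' : Integrable (fun y => starRingEnd ℂ (F (-y))) volume :=
    (Complex.conjCLE.toContinuousLinearMap.integrable_comp hF.comp_neg :)
  have hgauss : Integrable (fun ξ : Space 2 =>
      Complex.exp (-((4 * Real.pi ^ 2 * t : ℝ) : ℂ) * ‖ξ‖ ^ 2)) volume := by
    have := GaussianFourier.integrable_cexp_neg_mul_sq_norm_add (V := Space 2)
      (b := ((4 * Real.pi ^ 2 * t : ℝ) : ℂ)) (by rwa [Complex.ofReal_re]) 0 0
    simpa using this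
  have hwave : ∀ x, Integrable (fun ξ : Space 2 =>
      Complex.exp (-((4 * Real.pi ^ 2 * t : ℝ) : ℂ) * ‖ξ‖ ^ 2
      + 2 * Real.pi * Complex.I * (inner ℝ (-x) ξ : ℝ))) volume := fun x =>
    GaussianFourier.integrable_cexp_neg_mul_sq_norm_add (V := Space 2)
      (b := ((4 * Real.pi ^ 2 * t : ℝ) : ℂ)) (by rwa [Complex.ofReal_re]) _ (-x)
  have hgh : Integrable (fun ξ => Complex.exp (-((4 * Real.pi ^ 2 * t : ℝ) : ℂ) * ‖ξ‖ ^ 2) *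
      starRingEnd ℂ (𝓕 F ξ)) volume := by
    refine hgauss.mul_bdd (c := ∫ v, ‖F v‖)
      (Complex.continuous_conj.comp (continuous_fourier_of_integrable hF)).aestronglyMeasurable
      (ae_of_all _ fun ξ => ?_)
    rw [RCLike.norm_conj]
    exact VectorFourier.norm_fourierIntegral_le_integral_norm _ _ _ _ _
  calc ∫ ξ, ((Real.exp (-(4 * Real.pi ^ 2 * t) * ‖ξ‖ ^ 2) * ‖𝓕 F ξ‖ ^ 2 : ℝ) : ℂ)
      = ∫ ξ, 𝓕 F ξ • (Complex.exp (-((4 * Real.pi ^ 2 * t : ℝ) : ℂ) * ‖ξ‖ ^ 2) *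
          starRingEnd ℂ (𝓕 F ξ)) := by
        refine integral_congr_ae (ae_of_all _ fun ξ => ?_)
        have h := Complex.mul_conj' (𝓕 F ξ)
        simp only [smul_eq_mul]
        rw [mul_left_comm, h]
        push_cast
        ring
    _ = ∫ x, F x • 𝓕 (fun ξ => Complex.exp (-((4 * Real.pi ^ 2 * t : ℝ) : ℂ) * ‖ξ‖ ^ 2) *
          starRingEnd ℂ (𝓕 F ξ)) x := integral_fourier_smul_eq hF hgh
    _ = _ := by
        refine integral_congr_ae (ae_of_all _ fun x => ?_)
        simp only [smul_eq_mul]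
        congr 1
        calc 𝓕 (fun ξ => Complex.exp (-((4 * Real.pi ^ 2 * t : ℝ) : ℂ) * ‖ξ‖ ^ 2) *
              starRingEnd ℂ (𝓕 F ξ)) x
            = ∫ ξ, 𝓕 (fun y => starRingEnd ℂ (F (-y))) ξ •
              Complex.exp (-((4 * Real.pi ^ 2 * t : ℝ) : ℂ) * ‖ξ‖ ^ 2
              + 2 * Real.pi * Complex.I * (inner ℝ (-x) ξ : ℝ)) := by
              rw [Real.fourier_eq']
              refine integral_congr_ae (ae_of_all _ fun ξ => ?_)
              simp only [smul_eq_mul]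
              rw [← conj_fourier, Complex.exp_add, inner_neg_left, real_inner_comm]
              have : ((-2 * Real.pi * inner ℝ x ξ : ℝ) : ℂ) * Complex.I =
                  2 * Real.pi * Complex.I * ((-inner ℝ x ξ : ℝ) : ℂ) := by
                push_cast
                ring
              rw [this]
              ring
          _ = ∫ y, starRingEnd ℂ (F (-y)) • (heatKernel t (x + y) : ℂ) := by
              rw [integral_fourier_smul_eq hF' (hwave x)]
              simp only [fourier_heat_planeWave ht]
          _ = _ := by
              rw [← integral_neg_eq_self]
              simp only [neg_neg, ← sub_eq_add_neg, smul_eq_mul]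

lemma lintegral_gaussian_mul_fourier_le {F : Space 2 → ℂ} (hF : Integrable F volume) {t : ℝ}
    (ht : 0 < t) :
    ∫⁻ ξ, ENNReal.ofReal (Real.exp (-(4 * Real.pi ^ 2 * t) * ‖ξ‖ ^ 2) * ‖𝓕 F ξ‖ ^ 2) ≤
      ∫⁻ x, ∫⁻ y, ‖F x‖ₑ * ‖F y‖ₑ * ENNReal.ofReal (heatKernel t (x - y)) := by
  have hb : 0 < 4 * Real.pi ^ 2 * t := by positivity
  have hint : Integrable (fun ξ : Space 2 =>
      Real.exp (-(4 * Real.pi ^ 2 * t) * ‖ξ‖ ^ 2) * ‖𝓕 F ξ‖ ^ 2) volume := by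
    have hg : Integrable (fun ξ : Space 2 => Real.exp (-(4 * Real.pi ^ 2 * t) * ‖ξ‖ ^ 2)) volume := by
      have h := GaussianFourier.integral_rexp_neg_mul_sq_norm (V := Space 2) hb
      refine Integrable.of_integral_ne_zero ?_
      rw [h]
      positivity
    refine hg.mul_bdd (c := (∫ v, ‖F v‖) ^ 2)
      ((continuous_fourier_of_integrable hF).norm.pow 2).aestronglyMeasurable
      (ae_of_all _ fun ξ => ?_)
    rw [norm_pow, norm_norm]
    exact pow_le_pow_left₀ (norm_nonneg _)
      (VectorFourier.norm_fourierIntegral_le_integral_norm _ _ _ _ _) 2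
  have hnn : ∀ ξ : Space 2, 0 ≤ Real.exp (-(4 * Real.pi ^ 2 * t) * ‖ξ‖ ^ 2) * ‖𝓕 F ξ‖ ^ 2 :=
    fun ξ => by positivity
  rw [← ofReal_integral_eq_lintegral_ofReal hint (ae_of_all _ hnn)]
  have h1 : ENNReal.ofReal (∫ ξ, Real.exp (-(4 * Real.pi ^ 2 * t) * ‖ξ‖ ^ 2) * ‖𝓕 F ξ‖ ^ 2) =
      ‖∫ x, F x * ∫ y, starRingEnd ℂ (F y) * (heatKernel t (x - y) : ℂ)‖ₑ := by
    rw [← integral_gaussian_mul_fourier hF ht, integral_complex_ofReal, ← ofReal_norm,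
      Complex.norm_real, Real.norm_of_nonneg (integral_nonneg hnn)]
  rw [h1]
  refine (enorm_integral_le_lintegral_enorm _).trans (lintegral_mono fun x => ?_)
  simp only [mul_assoc]
  rw [enorm_mul, lintegral_const_mul' _ _ enorm_ne_top]
  refine mul_le_mul_right ((enorm_integral_le_lintegral_enorm _).trans
    (lintegral_mono fun y => ?_)) _
  rw [enorm_mul, ← ofReal_norm (x := starRingEnd ℂ (F y)), RCLike.norm_conj,
    ofReal_norm, ← ofReal_norm (x := (heatKernel t (x - y) : ℂ)),
    Complex.norm_real, Real.norm_of_nonneg (heatKernel_nonneg ht.le _)]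

/-- Schur's test for the heat kernel with weights `√w` on both sides. -/
lemma lintegral_heatKernel_schur_le {w : Space 2 → ℝ} (hw : Measurable w)
    {f : Space 2 → ℂ} (hf : Measurable f) {t : ℝ} :
    ∫⁻ x, ∫⁻ y, ‖(Real.sqrt (w x) : ℂ) * f x‖ₑ * ‖(Real.sqrt (w y) : ℂ) * f y‖ₑ *
        ENNReal.ofReal (heatKernel t (x - y)) ≤
      2 * ∫⁻ x, ‖f x‖ₑ ^ 2 * ∫⁻ y, ENNReal.ofReal (w y) *
        ENNReal.ofReal (heatKernel t (x - y)) := by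
  have hk : Measurable fun p : Space 2 × Space 2 => ENNReal.ofReal (heatKernel t (p.1 - p.2)) :=
    (measurable_heatKernel_uncurry.comp (measurable_const.prodMk
      (measurable_fst.sub measurable_snd))).ennreal_ofReal
  have hsq : ∀ y, ‖(Real.sqrt (w y) : ℂ)‖ₑ ^ 2 = ENNReal.ofReal (w y) := by
    intro y
    rw [← ofReal_norm, Complex.norm_real, Real.norm_of_nonneg (Real.sqrt_nonneg _),
      ← ENNReal.ofReal_pow (Real.sqrt_nonneg _)]
    rcases le_total 0 (w y) with h | h
    · rw [Real.sq_sqrt h]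
    · rw [Real.sqrt_eq_zero_of_nonpos h, ENNReal.ofReal_of_nonpos h]
      simp
  let A : Space 2 → Space 2 → ℝ≥0∞ := fun x y =>
    ‖f x‖ₑ ^ 2 * ENNReal.ofReal (w y) * ENNReal.ofReal (heatKernel t (x - y))
  have hA : Measurable (Function.uncurry A) :=
    (((hf.enorm.pow_const 2).comp measurable_fst).mul
      (hw.ennreal_ofReal.comp measurable_snd)).mul hk
  -- `a b ≤ a² + b²` with `a = |f(x)| √w(y)` and `b = |f(y)| √w(x)`
  have hpt : ∀ x y, ‖(Real.sqrt (w x) : ℂ) * f x‖ₑ * ‖(Real.sqrt (w y) : ℂ) * f y‖ₑ *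
      ENNReal.ofReal (heatKernel t (x - y)) ≤ A x y + A y x := by
    intro x y
    simp only [A, heatKernel_sub_comm t y x, ← add_mul, enorm_mul]
    refine mul_le_mul_left ?_ _
    rw [← hsq, ← hsq, ← mul_pow, ← mul_pow]
    have h1 : ‖(Real.sqrt (w x) : ℂ)‖ₑ * ‖f x‖ₑ * (‖(Real.sqrt (w y) : ℂ)‖ₑ * ‖f y‖ₑ) =
      (‖f x‖ₑ * ‖(Real.sqrt (w y) : ℂ)‖ₑ) * (‖f y‖ₑ * ‖(Real.sqrt (w x) : ℂ)‖ₑ) := by ring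
    rw [h1]
    rcases le_total (‖f x‖ₑ * ‖(Real.sqrt (w y) : ℂ)‖ₑ) (‖f y‖ₑ * ‖(Real.sqrt (w x) : ℂ)‖ₑ)
      with h | h
    · refine le_add_left ?_
      rw [sq]
      exact mul_le_mul_left h _
    · refine le_add_right ?_
      rw [sq]
      exact mul_le_mul_right h _
  calc _ ≤ ∫⁻ x, ∫⁻ y, (A x y + A y x) := lintegral_mono fun x => lintegral_mono fun y => hpt x y
    _ = (∫⁻ x, ∫⁻ y, A x y) + ∫⁻ x, ∫⁻ y, A y x := by
        rw [← lintegral_add_left hA.lintegral_prod_right]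
        refine lintegral_congr fun x => ?_
        exact lintegral_add_left (hA.comp measurable_prodMk_left) _
    _ = 2 * ∫⁻ x, ∫⁻ y, A x y := by
        rw [lintegral_lintegral_swap (f := fun x y => A y x)
          (hA.comp measurable_swap).aemeasurable, two_mul]
    _ = _ := by
        congr 1
        refine lintegral_congr fun x => ?_
        simp only [A, mul_assoc]
        rw [lintegral_const_mul' _ _ (by finiteness)]

end HeatKernel

/-! ### Potentials of finite entropy -/

section KatoBound

open ENNReal

lemma lintegral_inv_sqrt {N : ℝ} (hN : 1 ≤ N) :
    ∫⁻ t in Set.Ioc 0 (N⁻¹ ^ 2), ENNReal.ofReal (t ^ (-(1 / 2) : ℝ)) = ENNReal.ofReal (2 / N) := by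
  have hN0 : 0 < N := by linarith
  have hint : IntervalIntegrable (fun t : ℝ => t ^ (-(1 / 2) : ℝ)) volume 0 (N⁻¹ ^ 2) :=
    intervalIntegral.intervalIntegrable_rpow' (by norm_num)
  have hle : (0 : ℝ) ≤ N⁻¹ ^ 2 := by positivity
  rw [← ofReal_integral_eq_lintegral_ofReal
    ((intervalIntegrable_iff_integrableOn_Ioc_of_le hle).1 hint)
    ((ae_restrict_iff' measurableSet_Ioc).2 (ae_of_all _ fun t ht => Real.rpow_nonneg ht.1.le _)),
    ← intervalIntegral.integral_of_le hle, integral_rpow (Or.inl (by norm_num))]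
  congr 1
  have h1 : (-(1 / 2) + 1 : ℝ) = 1 / 2 := by norm_num
  rw [h1, Real.zero_rpow (by norm_num), ← Real.sqrt_eq_rpow, Real.sqrt_sq (by positivity)]
  field_simp
  ring

lemma lintegral_exp_mul_inv_le {s : ℝ} (hs : 0 < s) (hs1 : s ≤ 1) :
    ∫⁻ t in Set.Ioi s, ENNReal.ofReal (Real.exp (-t) * t⁻¹) ≤
      ENNReal.ofReal (-Real.log s + 1) := by
  have hexp : ∫⁻ t in Set.Ioi (1 : ℝ), ENNReal.ofReal (Real.exp (-t)) ≤ 1 := by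
    rw [← ofReal_integral_eq_lintegral_ofReal (integrableOn_exp_neg_Ioi 1)
      (ae_of_all _ fun t => (Real.exp_pos _).le), integral_exp_neg_Ioi]
    exact ENNReal.ofReal_le_one.2 (Real.exp_le_one_iff.2 (by norm_num))
  have hinv : ∫⁻ t in Set.Ioc s 1, ENNReal.ofReal t⁻¹ = ENNReal.ofReal (-Real.log s) := by
    have hint : IntervalIntegrable (fun t : ℝ => t⁻¹) volume s 1 :=
      intervalIntegrable_inv_iff.2 (Or.inr (by
        rw [Set.uIcc_of_le hs1]
        exact fun h => hs.not_ge h.1))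
    rw [← ofReal_integral_eq_lintegral_ofReal
      ((intervalIntegrable_iff_integrableOn_Ioc_of_le hs1).1 hint)
      ((ae_restrict_iff' measurableSet_Ioc).2 (ae_of_all _ fun t ht =>
        inv_nonneg.2 (hs.trans ht.1).le)),
      ← intervalIntegral.integral_of_le hs1, integral_inv_of_pos hs one_pos, one_div, Real.log_inv]
  rw [← Set.Ioc_union_Ioi_eq_Ioi hs1, ENNReal.ofReal_add
    (neg_nonneg.2 (Real.log_nonpos hs.le hs1)) zero_le_one, ENNReal.ofReal_one, ← hinv]
  refine (lintegral_union_le _ _ _).trans (add_le_add ?_ (le_trans ?_ hexp))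
  · refine setLIntegral_mono measurable_inv.ennreal_ofReal fun t ht =>
      ENNReal.ofReal_le_ofReal ?_
    exact mul_le_of_le_one_left (inv_nonneg.2 (hs.trans ht.1).le)
      (Real.exp_le_one_iff.2 (by linarith [hs.trans ht.1]))
  · refine setLIntegral_mono (by fun_prop) fun t ht => ENNReal.ofReal_le_ofReal ?_
    exact mul_le_of_le_one_right (Real.exp_pos _).le (inv_le_one_of_one_le₀ (le_of_lt ht))

/-- A function with values in `{0} ∪ (N, ∞)` and finite entropy has a small potential
`∫₀^∞ e^{-t} e^{tΔ} w dt`, uniformly in space. At time `t` the values of `w` below `t^{-1/2}` are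
estimated by `∫ p_t = 1` and those above by `p_t ≤ (4πt)⁻¹`. -/
lemma lintegral_heatKernel_potential_le {w : Space 2 → ℝ} (hw : Measurable w) {N : ℝ} (hN : 1 ≤ N)
    (hwN : ∀ y, w y = 0 ∨ N < w y) (x : Space 2) :
    ∫⁻ t in Set.Ioi (0 : ℝ), ENNReal.ofReal (Real.exp (-t)) *
        ∫⁻ y, ENNReal.ofReal (w y) * ENNReal.ofReal (heatKernel t (x - y)) ≤
      ENNReal.ofReal (2 / N) + ∫⁻ y, ENNReal.ofReal (w y * (2 * Real.log (w y) + 1)) := by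
  -- `A` bounds the contribution of the values of `w` below `t^{-1/2}`, `B` of those above
  let A : ℝ → ℝ≥0∞ := (Set.Ioc 0 (N⁻¹ ^ 2)).indicator fun t => ENNReal.ofReal (t ^ (-(1 / 2) : ℝ))
  let B : ℝ → Space 2 → ℝ≥0∞ := fun t y => ENNReal.ofReal (w y) *
    (Set.Ioi ((w y)⁻¹ ^ 2)).indicator (fun t => ENNReal.ofReal (Real.exp (-t) * t⁻¹)) t
  have hB : Measurable (Function.uncurry B) := by
    refine (hw.ennreal_ofReal.comp measurable_snd).mul ?_
    have hset : MeasurableSet {p : ℝ × Space 2 | (w p.2)⁻¹ ^ 2 < p.1} :=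
      measurableSet_lt ((hw.comp measurable_snd).inv.pow_const 2) measurable_fst
    exact (show Measurable fun p : ℝ × Space 2 => ENNReal.ofReal (Real.exp (-p.1) * p.1⁻¹)
      by fun_prop).indicator hset
  have hA : Measurable A := Measurable.indicator (by fun_prop) measurableSet_Ioc
  have hpt : ∀ t ∈ Set.Ioi (0 : ℝ), ∀ y, ENNReal.ofReal (Real.exp (-t)) *
      (ENNReal.ofReal (w y) * ENNReal.ofReal (heatKernel t (x - y))) ≤
        A t * ENNReal.ofReal (heatKernel t (x - y)) + B t y := by
    intro t ht y
    have ht0 : 0 < t := ht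
    rcases hwN y with h | h
    · simp [h]
    have hw0 : 0 < w y := by linarith
    by_cases hcase : (w y)⁻¹ ^ 2 < t
    · refine le_add_left ?_
      simp only [B]
      rw [Set.indicator_of_mem (Set.mem_Ioi.2 hcase), mul_left_comm,
        ← ENNReal.ofReal_mul (Real.exp_pos _).le]
      refine mul_le_mul_right (ENNReal.ofReal_le_ofReal
        (mul_le_mul_of_nonneg_left ((heatKernel_le ht0 _).trans ?_) (Real.exp_pos _).le)) _
      refine inv_anti₀ ht0 (le_mul_of_one_le_left ht0.le ?_)
      linarith [Real.pi_gt_three]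
    · refine le_add_right ?_
      rw [← mul_assoc, ← ENNReal.ofReal_mul (Real.exp_pos _).le]
      refine mul_le_mul_left ?_ _
      rw [not_lt] at hcase
      have hmem : t ∈ Set.Ioc 0 (N⁻¹ ^ 2) := by
        refine ⟨ht0, hcase.trans ?_⟩
        gcongr
      simp only [A]
      rw [Set.indicator_of_mem hmem]
      refine ENNReal.ofReal_le_ofReal ?_
      have h1 : Real.exp (-t) ≤ 1 := Real.exp_le_one_iff.2 (by linarith)
      refine (mul_le_of_le_one_left hw0.le h1).trans ?_
      rw [Real.rpow_neg ht0.le, ← Real.sqrt_eq_rpow]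
      refine (le_inv_comm₀ hw0 (Real.sqrt_pos.2 ht0)).2 ?_
      exact Real.sqrt_le_iff.2 ⟨by positivity, hcase⟩
  calc _ ≤ ∫⁻ t in Set.Ioi (0 : ℝ), (A t + ∫⁻ y, B t y) := by
        refine setLIntegral_mono (hA.add hB.lintegral_prod_right) fun t ht => ?_
        rw [← lintegral_const_mul' _ _ ENNReal.ofReal_ne_top]
        refine (lintegral_mono (hpt t ht)).trans ?_
        rw [lintegral_add_right _ (show Measurable (B t) from hB.comp measurable_prodMk_left)]
        refine add_le_add ?_ le_rfl
        rw [lintegral_const_mul _ (show Measurable fun y => ENNReal.ofReal (heatKernel t (x - y))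
          from (measurable_heatKernel_uncurry.comp (measurable_const.prodMk
            (measurable_const.sub measurable_id))).ennreal_ofReal),
          lintegral_heatKernel ht, mul_one]
    _ = (∫⁻ t in Set.Ioi (0 : ℝ), A t) + ∫⁻ y, ∫⁻ t in Set.Ioi (0 : ℝ), B t y := by
        rw [lintegral_add_left hA, lintegral_lintegral_swap hB.aemeasurable]
    _ ≤ _ := by
        refine add_le_add ?_ (lintegral_mono fun y => ?_)
        · refine (setLIntegral_le_lintegral _ _).trans ?_
          rw [lintegral_indicator measurableSet_Ioc, lintegral_inv_sqrt hN]
        · rcases hwN y with h | h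
          · simp [B, h]
          have hw0 : 0 < w y := by linarith
          simp only [B]
          rw [lintegral_const_mul' _ _ ENNReal.ofReal_ne_top, ENNReal.ofReal_mul hw0.le]
          refine mul_le_mul_right ((setLIntegral_le_lintegral _ _).trans ?_) _
          rw [lintegral_indicator measurableSet_Ioi]
          refine (lintegral_exp_mul_inv_le (by positivity)
            (pow_le_one₀ (by positivity) (inv_le_one_of_one_le₀ (by linarith)))).trans ?_
          refine ENNReal.ofReal_le_ofReal (le_of_eq ?_)
          rw [Real.log_pow, Real.log_inv]
          push_cast
          ring

end KatoBound

/-! ### Relative smallness of high potentials -/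

section FormBound

open FourierTransform ENNReal

/-- The symbol of `(-Δ + c)^{-1/2}` in the frequency variable `ξ = k / 2π`. -/
def besselSymbol {d : ℕ} (c : ℝ) (ξ : Space d) : ℝ :=
  (Real.sqrt (‖(2 * Real.pi) • ξ‖ ^ 2 + c))⁻¹

lemma besselSymbol_nonneg {d : ℕ} (c : ℝ) (ξ : Space d) : 0 ≤ besselSymbol c ξ :=
  inv_nonneg.2 (Real.sqrt_nonneg _)

lemma besselSymbol_sq {d : ℕ} {c : ℝ} (hc : 0 ≤ c) (ξ : Space d) :
    besselSymbol c ξ ^ 2 = (‖(2 * Real.pi) • ξ‖ ^ 2 + c)⁻¹ := by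
  rw [besselSymbol, inv_pow, Real.sq_sqrt (by positivity)]

lemma measurable_besselSymbol {d : ℕ} (c : ℝ) : Measurable (besselSymbol (d := d) c) := by
  unfold besselSymbol
  fun_prop

lemma besselSymbol_le {d : ℕ} {c : ℝ} (hc : 0 < c) (ξ : Space d) :
    |besselSymbol c ξ| ≤ (Real.sqrt c)⁻¹ := by
  rw [abs_of_nonneg (besselSymbol_nonneg c ξ), besselSymbol]
  exact inv_anti₀ (Real.sqrt_pos.2 hc) (Real.sqrt_le_sqrt (le_add_of_nonneg_left (by positivity)))

lemma isBddMul_besselSymbol {d : ℕ} {c : ℝ} (hc : 0 < c) : IsBddMul (besselSymbol (d := d) c) :=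
  ⟨(measurable_besselSymbol c).aemeasurable, _, besselSymbol_le hc⟩

lemma ofReal_besselSymbol_sq_le {d : ℕ} {c : ℝ} (hc : 1 ≤ c) (ξ : Space d) :
    ENNReal.ofReal (besselSymbol c ξ ^ 2) ≤ ∫⁻ t in Set.Ioi (0 : ℝ),
      ENNReal.ofReal (Real.exp (-t)) *
        ENNReal.ofReal (Real.exp (-(4 * Real.pi ^ 2 * t) * ‖ξ‖ ^ 2)) := by
  have hB : 0 < 4 * Real.pi ^ 2 * ‖ξ‖ ^ 2 + 1 := by positivity
  have hprod : ∀ t : ℝ, ENNReal.ofReal (Real.exp (-t)) *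
        ENNReal.ofReal (Real.exp (-(4 * Real.pi ^ 2 * t) * ‖ξ‖ ^ 2)) =
      ENNReal.ofReal (Real.exp (-(4 * Real.pi ^ 2 * ‖ξ‖ ^ 2 + 1) * t)) := by
    intro t
    rw [← ENNReal.ofReal_mul (Real.exp_pos _).le, ← Real.exp_add]
    congr 2
    ring
  simp only [hprod]
  rw [← ofReal_integral_eq_lintegral_ofReal (integrableOn_exp_mul_Ioi (neg_lt_zero.2 hB) 0)
    (ae_of_all _ fun t => (Real.exp_pos _).le), integral_exp_mul_Ioi (neg_lt_zero.2 hB),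
    besselSymbol_sq (by linarith)]
  refine ENNReal.ofReal_le_ofReal ?_
  rw [mul_zero, Real.exp_zero, neg_div_neg_eq, one_div]
  refine inv_anti₀ hB ?_
  rw [norm_smul, Real.norm_of_nonneg (by positivity), mul_pow, mul_pow]
  linarith

/-- The adjoint form of the smallness of a high potential with respect to `-Δ`. -/
lemma norm_besselSymbol_fourier_sqrt_le {w : Space 2 → ℝ} (hw : Measurable w)
    (hwi : Integrable w volume) {N : ℝ} (hN : 1 ≤ N) (hwN : ∀ y, w y = 0 ∨ N < w y)
    (hws : IsBddMul fun x => Real.sqrt (w x)) {c : ℝ} (hc : 1 ≤ c) {δ : ℝ} (hδ : 0 ≤ δ)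
    (hle : ENNReal.ofReal (2 / N) + ∫⁻ y, ENNReal.ofReal (w y * (2 * Real.log (w y) + 1)) ≤
      ENNReal.ofReal δ) (f : L2 (Space 2)) :
    ‖mulCLM (besselSymbol c) (fourierL2 2 (mulCLM (fun x => Real.sqrt (w x)) f))‖ ^ 2 ≤
      2 * δ * ‖f‖ ^ 2 := by
  have hm := isBddMul_besselSymbol (d := 2) (c := c) (by linarith)
  have hw0 : ∀ y, 0 ≤ w y := fun y => by rcases hwN y with h | h <;> linarith
  have hfm : Measurable f := (Lp.stronglyMeasurable f).measurable
  let F : Space 2 → ℂ := fun x => (Real.sqrt (w x) : ℂ) * f x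
  have hsqrt2 : MemLp (fun x => (Real.sqrt (w x) : ℂ)) 2 volume := by
    refine (memLp_two_iff_integrable_sq_norm (by fun_prop)).2 ?_
    refine hwi.congr (ae_of_all _ fun x => ?_)
    simp only [Complex.norm_real, Real.norm_of_nonneg (Real.sqrt_nonneg _), Real.sq_sqrt (hw0 x)]
  have hF : Integrable F volume := memLp_one_iff_integrable.1 ((Lp.memLp f).mul (r := 1) hsqrt2)
  have hFeq : mulCLM (fun x => Real.sqrt (w x)) f =ᵐ[volume] F := coeFn_mulCLM hws f
  have hFour : 𝓕 (mulCLM (fun x => Real.sqrt (w x)) f : Space 2 → ℂ) = 𝓕 F := by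
    funext ξ
    rw [Real.fourier_eq', Real.fourier_eq']
    refine integral_congr_ae ?_
    filter_upwards [hFeq] with x hx
    rw [hx]
  have hcont := continuous_fourier_of_integrable hF
  have hsq : ∀ g : L2 (Space 2), ENNReal.ofReal (‖g‖ ^ 2) = ∫⁻ x, ‖g x‖ₑ ^ 2 := by
    intro g
    rw [ENNReal.ofReal_pow (norm_nonneg _), Lp.norm_def, ENNReal.ofReal_toReal (Lp.eLpNorm_ne_top g)]
    have h := eLpNorm_nnreal_pow_eq_lintegral (μ := volume) (f := (g : Space 2 → ℂ)) (p := 2)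
      two_ne_zero
    simpa using h
  have hmain : ENNReal.ofReal
      (‖mulCLM (besselSymbol c) (fourierL2 2 (mulCLM (fun x => Real.sqrt (w x)) f))‖ ^ 2) ≤
      ENNReal.ofReal (2 * δ * ‖f‖ ^ 2) := by
    calc _ = ∫⁻ ξ, ENNReal.ofReal (besselSymbol c ξ ^ 2) * ENNReal.ofReal (‖𝓕 F ξ‖ ^ 2) := by
          rw [hsq]
          refine lintegral_congr_ae ?_
          filter_upwards [coeFn_mulCLM hm
            (fourierL2 2 (mulCLM (fun x => Real.sqrt (w x)) f)),
            coeFn_fourierL2 _ (hF.congr hFeq.symm)] with ξ h1 h2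
          rw [h1, h2, hFour, enorm_mul, mul_pow, ← ofReal_norm, ← ofReal_norm, Complex.norm_real,
            Real.norm_of_nonneg (besselSymbol_nonneg c ξ),
            ← ENNReal.ofReal_pow (besselSymbol_nonneg c ξ), ← ENNReal.ofReal_pow (norm_nonneg _)]
      _ ≤ ∫⁻ ξ, ∫⁻ t in Set.Ioi (0 : ℝ), ENNReal.ofReal (Real.exp (-t)) *
            ENNReal.ofReal (Real.exp (-(4 * Real.pi ^ 2 * t) * ‖ξ‖ ^ 2) * ‖𝓕 F ξ‖ ^ 2) := by
          refine lintegral_mono fun ξ => ?_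
          refine (mul_le_mul_left (ofReal_besselSymbol_sq_le hc ξ) _).trans (le_of_eq ?_)
          rw [← lintegral_mul_const' _ _ ENNReal.ofReal_ne_top]
          refine lintegral_congr fun t => ?_
          rw [ENNReal.ofReal_mul (Real.exp_pos _).le, mul_assoc]
      _ = ∫⁻ t in Set.Ioi (0 : ℝ), ENNReal.ofReal (Real.exp (-t)) *
            ∫⁻ ξ, ENNReal.ofReal (Real.exp (-(4 * Real.pi ^ 2 * t) * ‖ξ‖ ^ 2) * ‖𝓕 F ξ‖ ^ 2) := by
          rw [lintegral_lintegral_swap]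
          · refine lintegral_congr fun t => ?_
            rw [lintegral_const_mul' _ _ ENNReal.ofReal_ne_top]
          · refine Measurable.aemeasurable ?_
            have h1 : Measurable fun p : Space 2 × ℝ => ‖𝓕 F p.1‖ :=
              (hcont.comp continuous_fst).norm.measurable
            simp only [Function.uncurry_def]
            fun_prop
      _ ≤ ∫⁻ t in Set.Ioi (0 : ℝ), ENNReal.ofReal (Real.exp (-t)) *
            (2 * ∫⁻ x, ‖f x‖ₑ ^ 2 * ∫⁻ y, ENNReal.ofReal (w y) *
              ENNReal.ofReal (heatKernel t (x - y))) := by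
          refine lintegral_mono_ae ((ae_restrict_iff' measurableSet_Ioi).2 (ae_of_all _
            fun t ht => mul_le_mul_right ?_ _))
          exact (lintegral_gaussian_mul_fourier_le hF ht).trans
            (lintegral_heatKernel_schur_le hw hfm)
      _ = 2 * ∫⁻ x, ‖f x‖ₑ ^ 2 * ∫⁻ t in Set.Ioi (0 : ℝ), ENNReal.ofReal (Real.exp (-t)) *
            ∫⁻ y, ENNReal.ofReal (w y) * ENNReal.ofReal (heatKernel t (x - y)) := by
          have hk : Measurable fun p : (ℝ × Space 2) × Space 2 =>
              ENNReal.ofReal (w p.2) * ENNReal.ofReal (heatKernel p.1.1 (p.1.2 - p.2)) :=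
            (hw.ennreal_ofReal.comp measurable_snd).mul (measurable_heatKernel_uncurry.comp
              ((measurable_fst.comp measurable_fst).prodMk
                ((measurable_snd.comp measurable_fst).sub measurable_snd))).ennreal_ofReal
          have hk2 : Measurable fun p : ℝ × Space 2 => ∫⁻ y, ENNReal.ofReal (w y) *
              ENNReal.ofReal (heatKernel p.1 (p.2 - y)) := hk.lintegral_prod_right'
          have hf2 : Measurable fun p : ℝ × Space 2 => ‖f p.2‖ₑ ^ 2 :=
            (hfm.comp measurable_snd).enorm.pow_const 2
          have hswap := lintegral_lintegral_swap (μ := volume.restrict (Set.Ioi (0 : ℝ)))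
            (ν := (volume : Measure (Space 2)))
            (f := fun t x => ENNReal.ofReal (Real.exp (-t)) * (‖f x‖ₑ ^ 2 *
              ∫⁻ y, ENNReal.ofReal (w y) * ENNReal.ofReal (heatKernel t (x - y))))
            (Measurable.aemeasurable (Measurable.mul (by fun_prop) (hf2.mul hk2)))
          simp only [mul_left_comm _ (2 : ℝ≥0∞)]
          rw [lintegral_const_mul' _ _ (by simp)]
          congr 1
          calc _ = ∫⁻ t in Set.Ioi (0 : ℝ), ∫⁻ x, ENNReal.ofReal (Real.exp (-t)) * (‖f x‖ₑ ^ 2 *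
                ∫⁻ y, ENNReal.ofReal (w y) * ENNReal.ofReal (heatKernel t (x - y))) := by
                refine lintegral_congr fun t => ?_
                rw [lintegral_const_mul' _ _ ENNReal.ofReal_ne_top]
            _ = _ := by
                rw [hswap]
                refine lintegral_congr fun x => ?_
                simp only [mul_left_comm _ (‖f x‖ₑ ^ 2)]
                rw [lintegral_const_mul' _ _ (by finiteness)]
      _ ≤ 2 * ∫⁻ x, ‖f x‖ₑ ^ 2 * ENNReal.ofReal δ := by
          refine mul_le_mul_right (lintegral_mono fun x => mul_le_mul_right ?_ _) _
          exact (lintegral_heatKernel_potential_le hw hN hwN x).trans hle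
      _ = _ := by
          rw [lintegral_mul_const' _ _ ENNReal.ofReal_ne_top, ← hsq, mul_assoc,
            ENNReal.ofReal_mul zero_le_two, ENNReal.ofReal_mul hδ, mul_comm (ENNReal.ofReal δ)]
          simp
  exact (ENNReal.ofReal_le_ofReal_iff (by positivity)).1 hmain

/-- Smallness of a high potential of finite entropy with respect to `-Δ`. -/
lemma norm_potMul_sqrt_le {w : Space 2 → ℝ} (hw : Measurable w)
    (hwi : Integrable w volume) {N : ℝ} (hN : 1 ≤ N) (hwN : ∀ y, w y = 0 ∨ N < w y)
    (hws : IsBddMul fun x => Real.sqrt (w x)) {c : ℝ} (hc : 1 ≤ c) {δ : ℝ} (hδ : 0 ≤ δ)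
    (hle : ENNReal.ofReal (2 / N) + ∫⁻ y, ENNReal.ofReal (w y * (2 * Real.log (w y) + 1)) ≤
      ENNReal.ofReal δ) :
    ‖potMul (fun x => Real.sqrt (w x)) (besselSymbol c)‖ ≤ Real.sqrt (2 * δ) := by
  have hm := isBddMul_besselSymbol (d := 2) (c := c) (by linarith)
  refine ContinuousLinearMap.opNorm_le_bound _ (Real.sqrt_nonneg _) fun g => ?_
  set h := potMul (fun x => Real.sqrt (w x)) (besselSymbol c) g with hh
  rcases eq_or_ne h 0 with h0 | h0
  · rw [h0, norm_zero]
    positivity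
  have h1 : ‖h‖ ^ 2 ≤ ‖g‖ *
      ‖mulCLM (besselSymbol c) (fourierL2 2 (mulCLM (fun x => Real.sqrt (w x)) h))‖ := by
    have h2 : inner ℂ h h = inner ℂ g
        (mulCLM (besselSymbol c) (fourierL2 2 (mulCLM (fun x => Real.sqrt (w x)) h))) := by
      nth_rw 1 [hh]
      rw [potMul_apply, inner_mulCLM_left hws, ← (fourierL2 2).inner_map_map,
        LinearIsometryEquiv.apply_symm_apply, inner_mulCLM_left hm]
    have h3 := norm_inner_le_norm (𝕜 := ℂ) g
      (mulCLM (besselSymbol c) (fourierL2 2 (mulCLM (fun x => Real.sqrt (w x)) h)))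
    rw [← h2, inner_self_eq_norm_sq_to_K, norm_pow] at h3
    simpa using h3
  have h2 : ‖mulCLM (besselSymbol c) (fourierL2 2 (mulCLM (fun x => Real.sqrt (w x)) h))‖ ≤
      Real.sqrt (2 * δ) * ‖h‖ := by
    refine le_of_sq_le_sq ?_ (by positivity)
    rw [mul_pow, Real.sq_sqrt (by positivity)]
    exact norm_besselSymbol_fourier_sqrt_le hw hwi hN hwN hws hc hδ hle h
  have h3 : 0 < ‖h‖ := norm_pos_iff.2 h0
  refine le_of_mul_le_mul_right ?_ h3
  calc ‖h‖ * ‖h‖ = ‖h‖ ^ 2 := (sq _).symm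
    _ ≤ ‖g‖ * (Real.sqrt (2 * δ) * ‖h‖) := h1.trans (mul_le_mul_of_nonneg_left h2 (norm_nonneg _))
    _ = _ := by ring

end FormBound

/-! ### Compactness of `√U (-Δ + c)^{-1/2}` -/

section FormCompactness

lemma tendsto_besselSymbol {d : ℕ} (c : ℝ) :
    Tendsto (besselSymbol (d := d) c) (cocompact (Space d)) (𝓝 0) := by
  refine tendsto_inv_atTop_zero.comp (Real.tendsto_sqrt_atTop.comp
    (tendsto_atTop_add_const_right _ _ ((tendsto_pow_atTop two_ne_zero).comp ?_)))
  simp only [norm_smul]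
  exact Tendsto.const_mul_atTop (by rw [norm_pos_iff]; positivity)
    tendsto_norm_cocompact_atTop

/-- The part of `U` with values in `(s, t]`. -/
def slice {X : Type*} (U : X → ℝ) (s t : ℝ) : X → ℝ := {x | s < U x ∧ U x ≤ t}.indicator U

lemma slice_nonneg {X : Type*} {U : X → ℝ} (h0 : ∀ x, 0 ≤ U x) (s t : ℝ) (x : X) :
    0 ≤ slice U s t x := Set.indicator_nonneg (fun x _ => h0 x) x

lemma slice_le {X : Type*} {U : X → ℝ} (h0 : ∀ x, 0 ≤ U x) (s t : ℝ) (x : X) :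
    slice U s t x ≤ U x := Set.indicator_le_self' (fun x _ => h0 x) x

variable {U : Space 2 → ℝ}

lemma measurable_slice (hU : Measurable U) (s t : ℝ) : Measurable (slice U s t) :=
  hU.indicator ((measurableSet_lt measurable_const hU).inter (measurableSet_le hU measurable_const))

lemma sqrt_slice_le (s : ℝ) (t : ℝ) (x : Space 2) :
    |Real.sqrt (slice U s t x)| ≤ Real.sqrt t := by
  rw [abs_of_nonneg (Real.sqrt_nonneg _)]
  by_cases h : s < U x ∧ U x ≤ t
  · rw [slice, Set.indicator_of_mem (show x ∈ {x | s < U x ∧ U x ≤ t} from h)]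
    exact Real.sqrt_le_sqrt h.2
  · rw [slice, Set.indicator_of_notMem (show x ∉ {x | s < U x ∧ U x ≤ t} from h), Real.sqrt_zero]
    exact Real.sqrt_nonneg _

lemma isBddMul_sqrt_slice (hU : Measurable U) (s t : ℝ) :
    IsBddMul fun x => Real.sqrt (slice U s t x) :=
  ⟨(measurable_slice hU s t).sqrt.aemeasurable, _, sqrt_slice_le s t⟩

lemma sqrt_slice_sub {s t t' : ℝ} (hst : s ≤ t) (htt' : t ≤ t') (x : Space 2) :
    Real.sqrt (slice U s t' x) - Real.sqrt (slice U s t x) = Real.sqrt (slice U t t' x) := by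
  simp only [slice, Set.indicator_apply, Set.mem_ofPred_eq]
  by_cases h1 : s < U x
  · by_cases h2 : U x ≤ t
    · simp [h1, h2, h2.trans htt', not_lt.2 h2]
    · simp [h1, h2, not_le.1 h2]
  · have h2 : ¬ t < U x := fun h => h1 (hst.trans_lt h)
    simp [h1, h2]

lemma isCompactOperator_potMul_sqrt_slice (hU : Measurable U) (h0 : ∀ x, 0 ≤ U x)
    (hi : Integrable U volume) (s t : ℝ) {c : ℝ} (hc : 0 < c) :
    IsCompactOperator (potMul (fun x => Real.sqrt (slice U s t x)) (besselSymbol c)) := by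
  refine isCompactOperator_potMul_of_memLp (isBddMul_sqrt_slice hU s t) ?_
    (isBddMul_besselSymbol hc) (tendsto_besselSymbol c)
  refine (memLp_two_iff_integrable_sq
    (measurable_slice hU s t).sqrt.aestronglyMeasurable).2 ?_
  refine (hi.mono' (measurable_slice hU s t).aestronglyMeasurable (ae_of_all _ fun x => ?_)).congr
    (ae_of_all _ fun x => (Real.sq_sqrt (slice_nonneg h0 s t x)).symm)
  rw [Real.norm_of_nonneg (slice_nonneg h0 s t x)]
  exact slice_le h0 s t x

/-- The entropy `∫ U (2 log U + 1)` of the part of `U` above the level `N`. The integrand is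
nonnegative there if `N ≥ 1`. -/
def highEntropy (U : Space 2 → ℝ) (N : ℝ) : ENNReal :=
  ∫⁻ x in {x | N < U x}, ENNReal.ofReal (U x * (2 * Real.log (U x) + 1))

lemma lintegral_slice_le_highEntropy (hU : Measurable U) {N s t : ℝ} (hNs : N ≤ s) :
    ∫⁻ x, ENNReal.ofReal (slice U s t x * (2 * Real.log (slice U s t x) + 1)) ≤
      highEntropy U N := by
  rw [highEntropy, ← lintegral_indicator (measurableSet_lt measurable_const hU)]
  refine lintegral_mono fun x => ?_
  by_cases h : s < U x ∧ U x ≤ t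
  · have h1 : x ∈ {x | N < U x} := hNs.trans_lt h.1
    rw [slice, Set.indicator_of_mem (show x ∈ {x | s < U x ∧ U x ≤ t} from h),
      Set.indicator_of_mem h1]
  · rw [slice, Set.indicator_of_notMem (show x ∉ {x | s < U x ∧ U x ≤ t} from h)]
    simp

/-- By dominated convergence the entropy above a level tends to zero as the level increases. -/
lemma tendsto_highEntropy (hU : Measurable U) {N : ℝ} (hfin : highEntropy U N ≠ ⊤) :
    Tendsto (fun n : ℕ => highEntropy U (N + n)) atTop (𝓝 0) := by
  let h : Space 2 → ENNReal := fun x => ENNReal.ofReal (U x * (2 * Real.log (U x) + 1))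
  have hh : Measurable h := by
    have := hU.log
    fun_prop
  have hset : ∀ r : ℝ, MeasurableSet {x | r < U x} := fun r => measurableSet_lt measurable_const hU
  have heq : ∀ r : ℝ, highEntropy U r = ∫⁻ x, {x | r < U x}.indicator h x := fun r => by
    rw [highEntropy, lintegral_indicator (hset r)]
  simp only [heq]
  rw [heq] at hfin
  have := tendsto_lintegral_of_dominated_convergence (μ := (volume : Measure (Space 2)))
    (F := fun n : ℕ => {x | N + n < U x}.indicator h) (f := fun _ => 0) _
    (fun n => hh.indicator (hset _)) (fun n => ae_of_all _ fun x => ?_) hfin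
    (ae_of_all _ fun x => ?_)
  · simpa using this
  · refine Set.indicator_le_indicator_of_subset (fun x hx => ?_) (fun _ => zero_le) x
    have hx' : N + n < U x := hx
    exact lt_of_le_of_lt (le_add_of_nonneg_right (Nat.cast_nonneg n)) hx'
  · obtain ⟨n, hn⟩ := exists_nat_ge (U x - N)
    refine tendsto_const_nhds.congr' ?_
    filter_upwards [eventually_ge_atTop n] with k hk
    rw [Set.indicator_of_notMem]
    have : (n : ℝ) ≤ k := by exact_mod_cast hk
    simp only [Set.mem_ofPred_eq, not_lt]
    linarith

/-- For large `c`, the operator `√U (-Δ + c)^{-1/2}` is compact with norm less than `1`. It is the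
norm limit of the operators with `U` replaced by its parts below finite levels. -/
theorem exists_compact_sqrt_bessel (hU : Measurable U) (h0 : ∀ x, 0 ≤ U x)
    (hi : Integrable U volume) {N₀ : ℝ} (hN₀ : 1 ≤ N₀) (hfin : highEntropy U N₀ ≠ ⊤) (c₀ : ℝ) :
    ∃ c : ℝ, c₀ < c ∧ 0 < c ∧ ∃ M : L2 (Space 2) →L[ℂ] L2 (Space 2), IsCompactOperator M ∧
      ‖M‖ < 1 ∧ ∀ g, M g =ᵐ[volume] fun x => (Real.sqrt (U x) : ℂ) *
        (fourierL2 2).symm (mulCLM (besselSymbol c) g) x := by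
  have hN : ∀ n : ℕ, 1 ≤ N₀ + n := fun n =>
    hN₀.trans (le_add_of_nonneg_right (Nat.cast_nonneg n))
  have hfin' : ∀ n : ℕ, highEntropy U (N₀ + n) ≠ ⊤ := by
    intro n
    refine ne_top_of_le_ne_top hfin (lintegral_mono_set fun x hx => ?_)
    have hx' : N₀ + n < U x := hx
    exact lt_of_le_of_lt (le_add_of_nonneg_right (Nat.cast_nonneg n)) hx'
  let δ : ℕ → ℝ := fun n => 2 / (N₀ + n) + (highEntropy U (N₀ + n)).toReal
  have hδ0 : ∀ n, 0 ≤ δ n := fun n =>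
    add_nonneg (div_nonneg zero_le_two (zero_le_one.trans (hN n))) ENNReal.toReal_nonneg
  have hδ : Tendsto δ atTop (𝓝 0) := by
    have h1 : Tendsto (fun n : ℕ => 2 / (N₀ + n)) atTop (𝓝 0) :=
      tendsto_const_nhds.div_atTop
        (tendsto_atTop_add_const_left _ _ tendsto_natCast_atTop_atTop)
    have h2 := (ENNReal.tendsto_toReal ENNReal.zero_ne_top).comp (tendsto_highEntropy hU hfin)
    simpa using h1.add h2
  have hb : Tendsto (fun n => Real.sqrt (2 * δ n)) atTop (𝓝 0) := by
    simpa using (hδ.const_mul 2).sqrt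
  obtain ⟨n₀, hn₀⟩ := ((tendsto_order.1 hb).2 (1 / 2) (by norm_num)).exists
  -- `‖√U 1_{U ≤ N} (-Δ + c)^{-1/2}‖ ≤ √(N / c)` is made small by the choice of `c`
  obtain ⟨c, hc⟩ : ∃ c : ℝ, c = |c₀| + 4 * (N₀ + n₀) + 1 := ⟨_, rfl⟩
  have hc1 : 1 ≤ c := by
    have := abs_nonneg c₀
    have := hN n₀
    linarith
  refine ⟨c, ?_, by linarith, ?_⟩
  · have := le_abs_self c₀
    have := hN n₀
    linarith
  have hm := isBddMul_besselSymbol (d := 2) (c := c) (by linarith)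
  -- `-1` as the lower level makes the slice all of `{U ≤ t}`
  let s : ℕ → L2 (Space 2) →L[ℂ] L2 (Space 2) := fun n =>
    potMul (fun x => Real.sqrt (slice U (-1) (N₀ + n) x)) (besselSymbol c)
  have hsub : ∀ k n m : ℕ, k ≤ m → m ≤ n → ‖s n - s m‖ ≤ Real.sqrt (2 * δ k) := by
    intro k n m hkm hmn
    have hkm' : N₀ + (k : ℝ) ≤ N₀ + m := by gcongr
    have hmn' : N₀ + (m : ℝ) ≤ N₀ + n := by gcongr
    have h1 : s n - s m =
        potMul (fun x => Real.sqrt (slice U (N₀ + m) (N₀ + n) x)) (besselSymbol c) := by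
      simp only [s]
      rw [potMul_sub_left, mulCLM_sub (isBddMul_sqrt_slice hU _ _) (isBddMul_sqrt_slice hU _ _)]
      simp only [sqrt_slice_sub (show (-1 : ℝ) ≤ N₀ + m by linarith [hN m]) hmn']
      rfl
    rw [h1]
    refine norm_potMul_sqrt_le (measurable_slice hU _ _) ?_ (hN k) (fun y => ?_)
      (isBddMul_sqrt_slice hU _ _) hc1 (hδ0 k) ?_
    · refine hi.mono' (measurable_slice hU _ _).aestronglyMeasurable (ae_of_all _ fun x => ?_)
      rw [Real.norm_of_nonneg (slice_nonneg h0 _ _ x)]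
      exact slice_le h0 _ _ x
    · by_cases h : N₀ + m < U y ∧ U y ≤ N₀ + n
      · right
        rw [slice, Set.indicator_of_mem (show y ∈ {x | N₀ + m < U x ∧ U x ≤ N₀ + n} from h)]
        exact hkm'.trans_lt h.1
      · left
        rw [slice, Set.indicator_of_notMem
          (show y ∉ {x | N₀ + m < U x ∧ U x ≤ N₀ + n} from h)]
    · rw [ENNReal.ofReal_add (div_nonneg zero_le_two (zero_le_one.trans (hN k)))
        ENNReal.toReal_nonneg, ENNReal.ofReal_toReal (hfin' k)]
      exact add_le_add le_rfl (lintegral_slice_le_highEntropy hU hkm')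
  have hcauchy : CauchySeq s := by
    refine cauchySeq_of_le_tendsto_0 _ (fun n m k hkn hkm => ?_) hb
    rw [dist_eq_norm]
    rcases le_total m n with h | h
    · exact hsub k n m hkm h
    · rw [norm_sub_rev]
      exact hsub k m n hkn h
  obtain ⟨M, hM⟩ := cauchySeq_tendsto_of_complete hcauchy
  refine ⟨M, isCompactOperator_of_tendsto hM (Eventually.of_forall fun n =>
    isCompactOperator_potMul_sqrt_slice hU h0 hi _ _ (by linarith)), ?_, fun g => ?_⟩
  · have h1 : ‖M - s n₀‖ ≤ Real.sqrt (2 * δ n₀) := by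
      refine le_of_tendsto (hM.sub_const (s n₀)).norm ?_
      filter_upwards [eventually_ge_atTop n₀] with n hn
      exact hsub n₀ n n₀ le_rfl hn
    have h2 : ‖s n₀‖ ≤ 1 / 2 := by
      refine (norm_potMul_le _ _).trans ?_
      have h3 := norm_mulCLM_le (isBddMul_sqrt_slice hU (-1) (N₀ + n₀)).aemeasurable
        (Real.sqrt_nonneg _) (sqrt_slice_le (-1) (N₀ + n₀))
      have h4 := norm_mulCLM_le hm.aemeasurable (inv_nonneg.2 (Real.sqrt_nonneg _))
        (besselSymbol_le (c := c) (by linarith))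
      refine (mul_le_mul h3 h4 (norm_nonneg _) (Real.sqrt_nonneg _)).trans ?_
      rw [← div_eq_mul_inv, ← Real.sqrt_div' _ (by linarith)]
      refine Real.sqrt_le_iff.2 ⟨by norm_num, ?_⟩
      rw [div_le_iff₀ (by linarith)]
      have := abs_nonneg c₀
      linarith
    have h3 : ‖M‖ ≤ ‖M - s n₀‖ + ‖s n₀‖ := by
      simpa using norm_add_le (M - s n₀) (s n₀)
    linarith
  · have h1 : Tendsto (fun n => s n g) atTop (𝓝 (M g)) :=
      ((ContinuousLinearMap.apply ℂ (L2 (Space 2)) g).continuous.tendsto M).comp hM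
    obtain ⟨ns, hns, hae⟩ := (tendstoInMeasure_of_tendsto_Lp h1).exists_seq_tendsto_ae
    have h2 : ∀ᵐ x, ∀ n, s n g x = (Real.sqrt (slice U (-1) (N₀ + n) x) : ℂ) *
        (fourierL2 2).symm (mulCLM (besselSymbol c) g) x :=
      ae_all_iff.2 fun n => coeFn_mulCLM (isBddMul_sqrt_slice hU _ _) _
    filter_upwards [hae, h2] with x hx1 hx2
    refine tendsto_nhds_unique hx1 (tendsto_const_nhds.congr' ?_)
    obtain ⟨k, hk⟩ := exists_nat_ge (U x)
    filter_upwards [eventually_ge_atTop k] with n hn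
    rw [hx2]
    have h3 : x ∈ {x | -1 < U x ∧ U x ≤ N₀ + ns n} := by
      refine ⟨by linarith [h0 x], ?_⟩
      have : (k : ℝ) ≤ ns n := by exact_mod_cast hn.trans (hns.id_le n)
      linarith
    rw [slice, Set.indicator_of_mem h3]

end FormCompactness

/-! ### Operators defined by forms -/

section AbstractForm

variable {E H : Type*} [NormedAddCommGroup E] [InnerProductSpace ℂ E] [CompleteSpace E]
  [NormedAddCommGroup H] [InnerProductSpace ℂ H] [CompleteSpace H]

/-- Let the form of an operator, shifted by `c`, be `⟪q, p⟫ - ⟪P q, P p⟫` on a Hilbert space `H`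
mapped to `E` by `J`, with `P` compact and `‖P‖ < 1`. The resolvent at `-c` is then
`J (1 - P† P)⁻¹ J†`, a compact perturbation of `J J†`, and the spectrum is discrete in `(-c, 0)`. -/
theorem discrete_spec_of_form {G : Submodule ℂ (E × E)} {c μ : ℝ} (hμ : μ < 0) (hc : -μ < c)
    {J P : H →L[ℂ] E} (hP : IsCompactOperator P) (hP1 : ‖P‖ < 1) (hJ : ‖J‖ ^ 2 ≤ 1 / c)
    (hG : ∀ u g : E, (u, g + (-c : ℂ) • u) ∈ G ↔
      ∃ p, u = J p ∧ ∀ q, inner ℂ q p - inner ℂ (P q) (P p) = inner ℂ (J q) g)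
    (hspec : (μ : ℂ) ∈ spec G) :
    (∀ᶠ z in 𝓝[≠] (μ : ℂ), z ∉ spec G) ∧
      eigenspaceOf G μ ≠ ⊥ ∧ FiniteDimensional ℂ (eigenspaceOf G μ) := by
  let J' : E →L[ℂ] H := ContinuousLinearMap.adjoint J
  let P' : E →L[ℂ] H := ContinuousLinearMap.adjoint P
  have hJ' : ∀ q g, inner ℂ (J q) g = inner ℂ q (J' g) := fun q g =>
    (ContinuousLinearMap.adjoint_inner_right J q g).symm
  have hP' : ∀ q g, inner ℂ (P q) g = inner ℂ q (P' g) := fun q g =>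
    (ContinuousLinearMap.adjoint_inner_right P q g).symm
  let Q : H →L[ℂ] H := P' ∘L P
  have hQ : ‖Q‖ < 1 := by
    refine (ContinuousLinearMap.opNorm_comp_le _ _).trans_lt ?_
    rw [LinearIsometryEquiv.norm_map]
    nlinarith [norm_nonneg P]
  obtain ⟨A, hA⟩ : IsUnit (1 - Q) := isUnit_one_sub_of_norm_lt_one hQ
  let B : H →L[ℂ] H := ↑A⁻¹
  have hBA : ∀ p, B (p - Q p) = p := fun p => by
    have h : (B * (1 - Q)) p = p := by rw [← hA, Units.inv_mul, one_apply_eq_self]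
    exact h
  have hAB : ∀ p, B p - Q (B p) = p := fun p => by
    have h : ((1 - Q) * B) p = p := by rw [← hA, Units.mul_inv, one_apply_eq_self]
    exact h
  have hform : ∀ p q, inner ℂ q p - inner ℂ (P q) (P p) = inner ℂ q (p - Q p) := fun p q => by
    rw [inner_sub_right, hP']
    rfl
  refine discrete_spec_of_resolvent hμ hc (R := J ∘L B ∘L J') (S := J ∘L J')
    (K := J ∘L B ∘L Q ∘L J') ?_ ?_ ?_ ?_ ?_ hspec
  · intro u g
    rw [hG]
    simp only [hform, hJ', ← ext_iff_inner_left ℂ]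
    constructor
    · rintro ⟨p, rfl, hp⟩
      change J p = J (B (J' g))
      rw [← hp, hBA]
    · rintro rfl
      exact ⟨B (J' g), rfl, hAB _⟩
  · ext1 u
    change J (B (J' u)) = J (J' u) + J (B (Q (J' u)))
    rw [← map_add]
    congr 1
    have h := hBA (J' u)
    rw [map_sub] at h
    exact sub_eq_iff_eq_add.1 h
  · intro u v
    change inner ℂ (J (B (J' u))) v = inner ℂ u (J (B (J' v)))
    have hQs : ∀ p q, inner ℂ (Q p) q = inner ℂ p (Q q) := fun p q => by
      change inner ℂ (P' (P p)) q = inner ℂ p (P' (P q))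
      rw [← hP', ← inner_conj_symm, ← hP', inner_conj_symm]
    rw [hJ', ← inner_conj_symm u, hJ', inner_conj_symm]
    conv_lhs => rw [← hAB (J' v)]
    conv_rhs => rw [← hAB (J' u)]
    rw [inner_sub_right, inner_sub_left, hQs]
  · refine (ContinuousLinearMap.opNorm_comp_le _ _).trans (le_trans (le_of_eq ?_) hJ)
    rw [LinearIsometryEquiv.norm_map, sq]
  · have h : IsCompactOperator (Q ∘L J') := (hP.clm_comp P').comp_clm J'
    exact h.clm_comp (J ∘L B)

/-- The case of a form on a closed space of pairs `(g, h)`, given by the equation `A h = B g`,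
where the operators `J` and `P` depend on the first component only. -/
theorem discrete_spec_of_form_pairs {G : Submodule ℂ (E × E)} {c μ : ℝ} (hμ : μ < 0) (hc : -μ < c)
    {A B T M : E →L[ℂ] E} (hM : IsCompactOperator M) (hM1 : ‖M‖ < 1) (hT : ‖T‖ ^ 2 ≤ 1 / c)
    (hG : ∀ u f : E, (u, f + (-c : ℂ) • u) ∈ G ↔ ∃ g h, A h = B g ∧ u = T g ∧
      ∀ g' h', A h' = B g' →
        inner ℂ g' g + inner ℂ h' h - inner ℂ (M g') (M g) = inner ℂ (T g') f)
    (hspec : (μ : ℂ) ∈ spec G) :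
    (∀ᶠ z in 𝓝[≠] (μ : ℂ), z ∉ spec G) ∧
      eigenspaceOf G μ ≠ ⊥ ∧ FiniteDimensional ℂ (eigenspaceOf G μ) := by
  let N : Submodule ℂ (WithLp 2 (E × E)) :=
    (A ∘L WithLp.sndL 2 ℂ E E - B ∘L WithLp.fstL 2 ℂ E E).ker
  have hN : ∀ p : WithLp 2 (E × E), p ∈ N ↔ A p.snd = B p.fst := fun p => sub_eq_zero
  have hNc : CompleteSpace N :=
    IsClosed.completeSpace_coe (hs := ContinuousLinearMap.isClosed_ker _)
  let I : N →L[ℂ] E := WithLp.fstL 2 ℂ E E ∘L N.subtypeL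
  have hI : ‖I‖ ≤ 1 := by
    refine ContinuousLinearMap.opNorm_le_bound _ zero_le_one fun p => ?_
    rw [one_mul]
    refine le_of_sq_le_sq ?_ (norm_nonneg _)
    have h : ‖p‖ ^ 2 = ‖p.1.fst‖ ^ 2 + ‖p.1.snd‖ ^ 2 := WithLp.prod_norm_sq_eq_of_L2 p.1
    rw [h]
    exact le_add_of_nonneg_right (sq_nonneg _)
  refine discrete_spec_of_form hμ hc (J := T ∘L I) (P := M ∘L I) (hM.comp_clm I) ?_ ?_
    (fun u f => (hG u f).trans ?_) hspec
  · refine (ContinuousLinearMap.opNorm_comp_le _ _).trans_lt ?_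
    exact (mul_le_of_le_one_right (norm_nonneg _) hI).trans_lt hM1
  · refine le_trans ?_ hT
    gcongr
    exact (ContinuousLinearMap.opNorm_comp_le _ _).trans
      (mul_le_of_le_one_right (norm_nonneg _) hI)
  · constructor
    · rintro ⟨g, h, h1, h2, h3⟩
      exact ⟨⟨WithLp.toLp 2 (g, h), (hN _).2 h1⟩, h2, fun q => h3 _ _ ((hN _).1 q.2)⟩
    · rintro ⟨p, h1, h2⟩
      exact ⟨p.1.fst, p.1.snd, (hN _).1 p.2, h1, fun g' h' h3 =>
        h2 ⟨WithLp.toLp 2 (g', h'), (hN _).2 h3⟩⟩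

end AbstractForm

/-! ### The Sobolev space `H¹` -/

section Sobolev

variable {d : ℕ}

/-- The operator `(-Δ + c)^{-1/2}` from the frequency side to the space side. It maps `L²`
bijectively onto `H¹`. -/
def besselOp (d : ℕ) (c : ℝ) : L2 (Space d) →L[ℂ] L2 (Space d) :=
  ((fourierL2 d).symm : L2 (Space d) →L[ℂ] L2 (Space d)) ∘L mulCLM (besselSymbol c)

lemma besselOp_apply (c : ℝ) (g : L2 (Space d)) :
    besselOp d c g = (fourierL2 d).symm (mulCLM (besselSymbol c) g) := rfl

lemma norm_besselOp_le {c : ℝ} (hc : 0 < c) : ‖besselOp d c‖ ≤ (Real.sqrt c)⁻¹ := by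
  refine ContinuousLinearMap.opNorm_le_bound _ (by positivity) fun g => ?_
  rw [besselOp_apply, LinearIsometryEquiv.norm_map]
  refine ((mulCLM _).le_opNorm g).trans (mul_le_mul_of_nonneg_right ?_ (norm_nonneg _))
  exact norm_mulCLM_le (isBddMul_besselSymbol hc).aemeasurable (by positivity) (besselSymbol_le hc)

lemma fourierL2_besselOp {c : ℝ} (hc : 0 < c) (g : L2 (Space d)) :
    fourierL2 d (besselOp d c g) =ᵐ[volume] fun ξ => (besselSymbol c ξ : ℂ) * g ξ := by
  rw [besselOp_apply, LinearIsometryEquiv.apply_symm_apply]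
  exact coeFn_mulCLM (isBddMul_besselSymbol hc) g

lemma besselOp_mem_domain_absGrad {c : ℝ} (hc : 0 < c) (g : L2 (Space d)) :
    besselOp d c g ∈ (absGrad d).domain := by
  change MemLp (fun ξ => ((‖(2 * Real.pi) • ξ‖ : ℝ) : ℂ) * fourierL2 d (besselOp d c g) ξ) 2 volume
  refine (Lp.memLp g).of_le (AEStronglyMeasurable.mul
    (Continuous.aestronglyMeasurable (by fun_prop)) (Lp.aestronglyMeasurable _)) ?_
  filter_upwards [fourierL2_besselOp hc g] with ξ h
  rw [h, ← mul_assoc, norm_mul, ← Complex.ofReal_mul, Complex.norm_real,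
    Real.norm_of_nonneg (mul_nonneg (norm_nonneg _) (besselSymbol_nonneg _ _))]
  refine mul_le_of_le_one_left (norm_nonneg _) ?_
  rw [besselSymbol, ← div_eq_mul_inv]
  refine div_le_one_of_le₀ (Real.le_sqrt_of_sq_le ?_) (Real.sqrt_nonneg _)
  linarith

/-- The range of `(-Δ + c)^{-1/2}` contains `H¹`. -/
lemma exists_besselOp_eq {c : ℝ} (hc : 0 < c) {u : L2 (Space d)}
    (hu : u ∈ (absGrad d).domain) : ∃ g, besselOp d c g = u := by
  have hu' : MemLp (fun ξ => ((‖(2 * Real.pi) • ξ‖ : ℝ) : ℂ) * fourierL2 d u ξ) 2 volume := hu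
  have hg : MemLp (fun ξ => (((besselSymbol c ξ)⁻¹ : ℝ) : ℂ) * fourierL2 d u ξ) 2 volume := by
    refine (hu'.norm.add ((Lp.memLp (fourierL2 d u)).norm.const_mul (Real.sqrt c))).of_le
      (AEStronglyMeasurable.mul (Complex.measurable_ofReal.comp
        (measurable_besselSymbol c).inv).aestronglyMeasurable (Lp.aestronglyMeasurable _))
      (ae_of_all _ fun ξ => ?_)
    rw [norm_mul, Complex.norm_real, besselSymbol, inv_inv, Real.norm_of_nonneg (Real.sqrt_nonneg _)]
    refine le_trans ?_ (le_abs_self _)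
    simp only [Pi.add_apply, norm_mul, Complex.norm_real, norm_norm]
    rw [← add_mul]
    refine mul_le_mul_of_nonneg_right (Real.sqrt_le_iff.2 ⟨by positivity, ?_⟩) (norm_nonneg _)
    nlinarith [Real.sq_sqrt hc.le, mul_nonneg (norm_nonneg ((2 * Real.pi) • ξ)) (Real.sqrt_nonneg c)]
  refine ⟨hg.toLp, ?_⟩
  rw [besselOp_apply, LinearIsometryEquiv.symm_apply_eq]
  refine Lp.ext ?_
  filter_upwards [coeFn_mulCLM (isBddMul_besselSymbol hc) hg.toLp, hg.coeFn_toLp] with ξ h1 h2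
  have hne : besselSymbol c ξ ≠ 0 := by
    rw [besselSymbol]
    positivity
  rw [h1, h2, ← mul_assoc, ← Complex.ofReal_mul, mul_inv_cancel₀ hne, Complex.ofReal_one, one_mul]

lemma coeFn_fourierL2_absGrad {u : L2 (Space d)} (h : u ∈ (absGrad d).domain) :
    fourierL2 d (absGrad d ⟨u, h⟩) =ᵐ[volume]
      fun ξ => ((‖(2 * Real.pi) • ξ‖ : ℝ) : ℂ) * fourierL2 d u ξ := by
  have h1 : fourierL2 d (absGrad d ⟨u, h⟩) =
      (mulOp fun ξ : Space d => ‖(2 * Real.pi) • ξ‖) ⟨fourierL2 d u, h⟩ :=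
    fourierL2_fourierOp (a := fun k => ‖k‖) u h
  rw [h1]
  exact coeFn_mulOp (m := fun ξ : Space d => ‖(2 * Real.pi) • ξ‖) h

/-- In terms of `g = (-Δ + c)^{1/2} u` the form of `-Δ + c` is the inner product of `L²`. -/
lemma inner_absGrad_besselOp {c : ℝ} (hc : 0 < c) (g g' : L2 (Space d))
    (h : besselOp d c g ∈ (absGrad d).domain) (h' : besselOp d c g' ∈ (absGrad d).domain) :
    inner ℂ (absGrad d ⟨_, h'⟩) (absGrad d ⟨_, h⟩) +
      (c : ℂ) * inner ℂ (besselOp d c g') (besselOp d c g) = inner ℂ g' g := by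
  rw [← (fourierL2 d).inner_map_map (absGrad d ⟨_, h'⟩),
    ← (fourierL2 d).inner_map_map (besselOp d c g'), L2.inner_def, L2.inner_def, L2.inner_def,
    ← integral_const_mul, ← integral_add (L2.integrable_inner _ _)
      ((L2.integrable_inner _ _).const_mul _)]
  refine integral_congr_ae ?_
  filter_upwards [coeFn_fourierL2_absGrad h, coeFn_fourierL2_absGrad h', fourierL2_besselOp hc g,
    fourierL2_besselOp hc g'] with ξ h1 h2 h3 h4
  rw [h1, h2, h3, h4]
  simp only [RCLike.inner_apply, map_mul, Complex.conj_ofReal]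
  have hs : ((‖(2 * Real.pi) • ξ‖ : ℝ) : ℂ) ^ 2 * (besselSymbol c ξ : ℂ) ^ 2 +
      (c : ℂ) * (besselSymbol c ξ : ℂ) ^ 2 = 1 := by
    rw [← add_mul]
    have hs' : (‖(2 * Real.pi) • ξ‖ ^ 2 + c) * besselSymbol c ξ ^ 2 = 1 := by
      rw [besselSymbol_sq hc.le]
      exact mul_inv_cancel₀ (by positivity)
    exact_mod_cast hs'
  linear_combination (g ξ * starRingEnd ℂ (g' ξ)) * hs

end Sobolev

/-! ### The form of `-Δ - W` -/

section SchrodingerForm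

variable {d : ℕ}

/-- The graph of multiplication by `r ≥ 0` as the set of solutions of an equation between bounded
operators. -/
lemma mulCLM_eq_mulCLM_iff {X : Type*} [MeasureSpace X] {r : X → ℝ} (hr : AEMeasurable r volume)
    (hr0 : ∀ x, 0 ≤ r x) (u h : L2 X) :
    mulCLM (fun x => (1 + r x)⁻¹) h = mulCLM (fun x => r x * (1 + r x)⁻¹) u ↔
      h =ᵐ[volume] fun x => (r x : ℂ) * u x := by
  have hA : IsBddMul fun x => (1 + r x)⁻¹ := by
    refine ⟨(hr.const_add 1).inv, 1, fun x => ?_⟩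
    have := hr0 x
    rw [abs_of_nonneg (by positivity)]
    exact inv_le_one_of_one_le₀ (by linarith)
  have hB : IsBddMul fun x => r x * (1 + r x)⁻¹ := by
    refine ⟨hr.mul (hr.const_add 1).inv, 1, fun x => ?_⟩
    have := hr0 x
    rw [abs_of_nonneg (by positivity), ← div_eq_mul_inv]
    exact div_le_one_of_le₀ (by linarith) (by positivity)
  have hne : ∀ x, ((1 : ℂ) + r x) ≠ 0 := by
    intro x
    have := hr0 x
    norm_cast
    positivity
  rw [Lp.ext_iff]
  constructor
  · intro h
    filter_upwards [h, coeFn_mulCLM hA _, coeFn_mulCLM hB u] with x h2 h3 h4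
    rw [h3, h4] at h2
    push_cast at h2
    have := hne x
    field_simp at h2
    exact h2
  · intro h
    filter_upwards [h, coeFn_mulCLM hA _, coeFn_mulCLM hB u] with x h2 h3 h4
    rw [h3, h4, h2]
    push_cast
    ring

lemma sqrt_abs_eq (s : ℝ) : Real.sqrt |s| = Real.sqrt s + Real.sqrt (-s) := by
  rcases le_total 0 s with h | h
  · rw [abs_of_nonneg h, Real.sqrt_eq_zero_of_nonpos (neg_nonpos.2 h), add_zero]
  · rw [abs_of_nonpos h, Real.sqrt_eq_zero_of_nonpos h, zero_add]

lemma sqrt_sq_sub_sqrt_neg_sq (s : ℝ) : Real.sqrt s ^ 2 - Real.sqrt (-s) ^ 2 = s := by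
  rcases le_total 0 s with h | h
  · rw [Real.sq_sqrt h, Real.sqrt_eq_zero_of_nonpos (neg_nonpos.2 h)]
    ring
  · rw [Real.sq_sqrt (neg_nonneg.2 h), Real.sqrt_eq_zero_of_nonpos h]
    ring

/-- The pairs `(g, h)` with `h = √W₋ (-Δ + c)^{-1/2} g`. They parametrize the form domain of
`-Δ - W`, and `‖g‖² + ‖h‖²` is the form of `-Δ + W₋ + c` at `(-Δ + c)^{-1/2} g`. -/
def IsFormPair (W : Space d → ℝ) (c : ℝ) (g h : L2 (Space d)) : Prop :=
  h =ᵐ[volume] fun x => (Real.sqrt (-W x) : ℂ) * besselOp d c g x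

variable {W : Space d → ℝ} {c : ℝ} {M : L2 (Space d) →L[ℂ] L2 (Space d)}

/-- Every element of the form domain comes from a form pair, as `W₋ ≤ |W|`. -/
lemma exists_isFormPair (hW : AEMeasurable W volume) (hc : 0 < c) {u : L2 (Space d)}
    (hu : u ∈ formDomain W) : ∃ g h, IsFormPair W c g h ∧ u = besselOp d c g := by
  have hr : AEMeasurable (fun x => Real.sqrt (-W x)) volume := hW.neg.sqrt
  obtain ⟨h1, h2⟩ := hu
  obtain ⟨g, rfl⟩ := exists_besselOp_eq hc h1
  have h2' : MemLp (fun x => ((Real.sqrt |W x| : ℝ) : ℂ) * besselOp d c g x) 2 volume := h2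
  have h3 : MemLp (fun x => (Real.sqrt (-W x) : ℂ) * besselOp d c g x) 2 volume := by
    refine h2'.of_le ((Complex.measurable_ofReal.comp_aemeasurable hr).aestronglyMeasurable.mul
      (Lp.aestronglyMeasurable _)) (ae_of_all _ fun x => ?_)
    rw [norm_mul, norm_mul, Complex.norm_real, Complex.norm_real,
      Real.norm_of_nonneg (Real.sqrt_nonneg _), Real.norm_of_nonneg (Real.sqrt_nonneg _)]
    exact mul_le_mul_of_nonneg_right (Real.sqrt_le_sqrt (neg_le_abs _)) (norm_nonneg _)
  exact ⟨g, h3.toLp, h3.coeFn_toLp, rfl⟩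

/-- Conversely a form pair gives an element of the form domain, as `√W₊ u = M g` is in `L²`. -/
lemma IsFormPair.mem_formDomain (hc : 0 < c)
    (hM : ∀ g, M g =ᵐ[volume] fun x => (Real.sqrt (W x) : ℂ) * besselOp d c g x)
    {g h : L2 (Space d)} (hgh : IsFormPair W c g h) : besselOp d c g ∈ formDomain W := by
  refine ⟨besselOp_mem_domain_absGrad hc _, ?_⟩
  change MemLp (fun x => ((Real.sqrt |W x| : ℝ) : ℂ) * besselOp d c g x) 2 volume
  refine ((Lp.memLp (M g)).add (Lp.memLp h)).ae_eq ?_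
  filter_upwards [hM g, hgh] with x h1 h2
  rw [Pi.add_apply, h1, h2, sqrt_abs_eq]
  push_cast
  ring

/-- The form of `-Δ - W + c` in terms of form pairs. -/
lemma schrodingerForm_add_eq (hc : 0 < c)
    (hM : ∀ g, M g =ᵐ[volume] fun x => (Real.sqrt (W x) : ℂ) * besselOp d c g x)
    {g h g' h' : L2 (Space d)} (hgh : IsFormPair W c g h) (hgh' : IsFormPair W c g' h')
    (hg : besselOp d c g ∈ formDomain W) (hg' : besselOp d c g' ∈ formDomain W) :
    schrodingerForm W ⟨_, hg⟩ ⟨_, hg'⟩ +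
      (c : ℂ) * inner ℂ (besselOp d c g') (besselOp d c g) =
        inner ℂ g' g + inner ℂ h' h - inner ℂ (M g') (M g) := by
  have hpot : ∫ x, (W x : ℂ) * besselOp d c g x * starRingEnd ℂ (besselOp d c g' x) =
      inner ℂ (M g') (M g) - inner ℂ h' h := by
    rw [L2.inner_def, L2.inner_def,
      ← integral_sub (L2.integrable_inner _ _) (L2.integrable_inner _ _)]
    refine integral_congr_ae ?_
    filter_upwards [hM g, hM g', hgh, hgh'] with x h1 h2 h3 h4
    rw [h1, h2, h3, h4]
    simp only [RCLike.inner_apply, map_mul, Complex.conj_ofReal]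
    have hs : (Real.sqrt (W x) : ℂ) ^ 2 - (Real.sqrt (-W x) : ℂ) ^ 2 = W x := by
      exact_mod_cast sqrt_sq_sub_sqrt_neg_sq (W x)
    rw [← hs]
    ring
  have hgrad := inner_absGrad_besselOp hc g g' hg.1 hg'.1
  rw [← hgrad, schrodingerForm, hpot]
  ring

/-- Discreteness of the negative spectrum of `-Δ - W` when `√W₊ (-Δ + c)^{-1/2}` is compact with
norm less than `1`. -/
theorem discrete_schrodinger_of_compact (hW : AEMeasurable W volume) {μ : ℝ} (hμ : μ < 0)
    (hc : -μ < c)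
    (hM : ∀ g, M g =ᵐ[volume] fun x => (Real.sqrt (W x) : ℂ) * besselOp d c g x)
    (hMc : IsCompactOperator M) (hM1 : ‖M‖ < 1) (hspec : (μ : ℂ) ∈ spec (schrodingerGraph W hW)) :
    (∀ᶠ z in 𝓝[≠] (μ : ℂ), z ∉ spec (schrodingerGraph W hW)) ∧
      eigenspaceOf (schrodingerGraph W hW) μ ≠ ⊥ ∧
        FiniteDimensional ℂ (eigenspaceOf (schrodingerGraph W hW) μ) := by
  have hc0 : 0 < c := by linarith
  have hpair : ∀ g h : L2 (Space d), mulCLM (fun x => (1 + Real.sqrt (-W x))⁻¹) h =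
      (mulCLM (fun x => Real.sqrt (-W x) * (1 + Real.sqrt (-W x))⁻¹) ∘L besselOp d c) g ↔
      IsFormPair W c g h := fun g h =>
    mulCLM_eq_mulCLM_iff hW.neg.sqrt (fun x => Real.sqrt_nonneg _) (besselOp d c g) h
  refine discrete_spec_of_form_pairs hμ hc
    (A := mulCLM fun x => (1 + Real.sqrt (-W x))⁻¹)
    (B := mulCLM (fun x => Real.sqrt (-W x) * (1 + Real.sqrt (-W x))⁻¹) ∘L besselOp d c)
    (T := besselOp d c) hMc hM1 ?_ (fun u f => ?_) hspec
  · have h := norm_besselOp_le (d := d) hc0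
    refine (pow_le_pow_left₀ (norm_nonneg (besselOp d c)) h 2).trans (le_of_eq ?_)
    rw [inv_pow, Real.sq_sqrt hc0.le, one_div]
  · simp only [hpair]
    have hshift : ∀ v u : L2 (Space d), inner ℂ v (f + (-c : ℂ) • u) =
        inner ℂ v f - (c : ℂ) * inner ℂ v u := fun v u => by
      rw [inner_add_right, inner_smul_right]
      ring
    constructor
    · rintro ⟨hu, hform⟩
      obtain ⟨g, h, hgh, rfl⟩ := exists_isFormPair hW hc0 hu
      refine ⟨g, h, hgh, rfl, fun g' h' hgh' => ?_⟩
      have hg' := hgh'.mem_formDomain hc0 hM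
      rw [← schrodingerForm_add_eq hc0 hM hgh hgh' hu hg', hform ⟨_, hg'⟩, hshift]
      ring
    · rintro ⟨g, h, hgh, rfl, hform⟩
      have hg := hgh.mem_formDomain hc0 hM
      refine ⟨hg, ?_⟩
      rintro ⟨v, hv⟩
      obtain ⟨g', h', hgh', rfl⟩ := exists_isFormPair hW hc0 hv
      rw [hshift, ← hform g' h' hgh', ← schrodingerForm_add_eq hc0 hM hgh hgh' hg hv]
      ring

end SchrodingerForm

/-! ### The planar Schrödinger operator -/

section PlanarSchrodinger

/-- Since `log (2 + |x|) ≥ log 2`, a finite logarithmic moment gives integrability. -/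
lemma integrable_posPart_of_log {V : Space 2 → ℝ} (hV : AEMeasurable V volume)
    (hlog : Integrable (fun x => max (V x) 0 * Real.log (2 + ‖x‖)) volume) :
    Integrable (fun x => max (V x) 0) volume := by
  refine (hlog.const_mul (Real.log 2)⁻¹).mono' (hV.max aemeasurable_const).aestronglyMeasurable
    (ae_of_all _ fun x => ?_)
  have h2 : 0 < Real.log 2 := Real.log_pos one_lt_two
  rw [Real.norm_of_nonneg (le_max_right _ _), mul_left_comm]
  refine le_mul_of_one_le_right (le_max_right _ _) ?_
  rw [inv_mul_eq_div, one_le_div h2]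
  exact Real.log_le_log two_pos (le_add_of_nonneg_right (norm_nonneg x))

lemma highEntropy_max_mul_ne_top {V : Space 2 → ℝ} (hV : Measurable V)
    (hint : Integrable (fun x => max (V x) 0) volume)
    (hent : IntegrableOn (fun x => V x * Real.log (V x)) {x | 1 < V x} volume) {σ : ℝ}
    (hσ : 0 < σ) : highEntropy (fun x => max (σ * V x) 0) (max 1 σ) ≠ ⊤ := by
  have hset : MeasurableSet {x | 1 < V x} := measurableSet_lt measurable_const hV
  have hVint : IntegrableOn V {x | 1 < V x} volume := by
    refine hint.integrableOn.congr_fun (fun x hx => ?_) hset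
    exact max_eq_left (zero_le_one.trans (le_of_lt hx))
  have h1 : IntegrableOn (fun x => max (σ * V x) 0 * (2 * Real.log (max (σ * V x) 0) + 1))
      {x | 1 < V x} volume := by
    have h2 : IntegrableOn (fun x => 2 * σ * (V x * Real.log (V x)) +
        σ * (2 * Real.log σ + 1) * V x) {x | 1 < V x} volume :=
      (hent.const_mul (2 * σ)).add (hVint.const_mul (σ * (2 * Real.log σ + 1)))
    refine h2.congr_fun (fun x hx => ?_) hset
    have hx0 : 0 < V x := zero_lt_one.trans hx
    simp only
    rw [max_eq_left (by positivity), Real.log_mul hσ.ne' hx0.ne']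
    ring
  -- above the level `max 1 σ` of `σ V` the potential `V` itself exceeds `1`
  refine ne_top_of_le_ne_top h1.lintegral_lt_top.ne (lintegral_mono_set fun x hx => ?_)
  have hx1 : max 1 σ < max (σ * V x) 0 := hx
  have hx2 : σ < σ * V x := by
    rcases lt_max_iff.1 ((le_max_right 1 σ).trans_lt hx1) with h | h
    · exact h
    · exact absurd h hσ.le.not_gt
  exact (lt_mul_iff_one_lt_right hσ).1 hx2

/-- The negative spectrum of the operator of the form of `-Δ - σ V` in the plane is discrete when
`V₊` has a finite logarithmic moment, of which only `V₊ ∈ L¹` is used, and a finite entropy. -/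
theorem discrete_planar_schrodinger {V : Space 2 → ℝ} {σ : ℝ} (hV : AEMeasurable V volume)
    (hlog : Integrable (fun x => max (V x) 0 * Real.log (2 + ‖x‖)) volume)
    (hent : IntegrableOn (fun x => V x * Real.log (V x)) {x | 1 < V x} volume) (hσ : 0 < σ) :
    HasDiscreteNegativeSpectrum (schrodingerGraph (fun x => σ * V x) (hV.const_mul σ)) := by
  intro μ hμ hspec
  -- `M` is built from a measurable representative of `V`
  let V' : Space 2 → ℝ := hV.mk V
  have hV' : Measurable V' := hV.measurable_mk
  have hae : V =ᵐ[volume] V' := hV.ae_eq_mk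
  have hint : Integrable (fun x => max (V' x) 0) volume :=
    (integrable_posPart_of_log hV hlog).congr (by filter_upwards [hae] with x hx; rw [hx])
  have hsets : ({x | 1 < V x} : Set (Space 2)) =ᵐ[volume] {x | 1 < V' x} := by
    filter_upwards [hae] with x hx
    exact propext (show 1 < V x ↔ 1 < V' x by rw [hx])
  have hent' : IntegrableOn (fun x => V' x * Real.log (V' x)) {x | 1 < V' x} volume := by
    refine (hent.congr_set_ae hsets.symm).congr_fun_ae (ae_restrict_of_ae ?_)
    filter_upwards [hae] with x hx
    rw [hx]
  have hUint : Integrable (fun x => max (σ * V' x) 0) volume := by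
    refine (hint.const_mul σ).congr (ae_of_all _ fun x => ?_)
    simp only
    rw [mul_max_of_nonneg _ _ hσ.le, mul_zero]
  obtain ⟨c, hc, -, M, hMc, hM1, hM⟩ := exists_compact_sqrt_bessel
    (U := fun x => max (σ * V' x) 0) ((hV'.const_mul σ).max measurable_const)
    (fun x => le_max_right _ _) hUint (le_max_left 1 σ)
    (highEntropy_max_mul_ne_top hV' hint hent' hσ) (-μ)
  refine discrete_schrodinger_of_compact (hV.const_mul σ) hμ hc (fun g => ?_) hMc hM1 hspec
  filter_upwards [hM g, hae] with x h1 h2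
  rw [h1, h2, besselOp_apply]
  congr 2
  rcases le_total 0 (σ * V' x) with h | h
  · rw [max_eq_left h]
  · rw [max_eq_right h, Real.sqrt_zero, Real.sqrt_eq_zero_of_nonpos h]

end PlanarSchrodinger

end NegSpec

end

theorem mainTheorem6 :
    -- (a) a bounded potential vanishing at infinity, `A` a Fourier multiplier
    (∀ (d : ℕ) (_hd : 1 ≤ d) (a V : NegSpec.Space d → ℝ) (σ : ℝ),
      Continuous a →
      (∀ k, k ≠ 0 → 0 < a k) →
      (∃ C : ℝ, ∀ᶠ k in 𝓝 0, a k ≤ C * ‖k‖ ^ d) →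
      Tendsto a (cocompact (NegSpec.Space d)) atTop →
      AEMeasurable V volume →
      (∃ M : ℝ, ∀ x, |V x| ≤ M) →
      Tendsto V (cocompact (NegSpec.Space d)) (𝓝 0) →
      0 < σ →
      NegSpec.HasDiscreteNegativeSpectrum
        (NegSpec.fourierOp a - (σ : ℂ) • NegSpec.mulOp V).graph) ∧
    -- (b) the two-dimensional Schrödinger operator
    (∀ (V : NegSpec.Space 2 → ℝ) (σ : ℝ) (hV : AEMeasurable V volume),
      Integrable (fun x => max (V x) 0 * Real.log (2 + ‖x‖)) volume →
      IntegrableOn (fun x => V x * Real.log (V x)) {x | 1 < V x} volume →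
      0 < σ →
      NegSpec.HasDiscreteNegativeSpectrum
        (NegSpec.schrodingerGraph (fun x => σ * V x) (hV.const_mul σ))) := by
  refine ⟨fun d hd a V σ ha hpos _ ha1 hV hM hV0 hσ => ?_, fun V σ hV hlog hent hσ => ?_⟩
  · obtain ⟨M, hM⟩ := hM
    exact NegSpec.discrete_multiplier_sub_potential ha.measurable
      (NegSpec.nonneg_of_continuous_of_pos hd ha hpos) ha1 hV hM hV0 hσ
  · exact NegSpec.discrete_planar_schrodinger hV hlog hent hσ
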